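/- A *prop* is a strict symmetric monoidal category whose objects are the natural numbers, with tensor product of objects given by addition; a *morphism of props* is a strict symmetric monoidal functor that is the identity on objects. Let $\mathrm{PROP}$ be the category of props. Let $L$ be any set. An *$L$-circuit* from a finite set $X$ to a finite set $Y$ is a cospan of finite sets $X \xrightarrow{i} N \xleftarrow{o} Y$ together with a finite set $E$ and functions $s,t\colon E \to N$ and $\ell\colon E \to L$ (a finite directed $L$-labelled multigraph with node set $N$). Two $L$-circuits from $X$ to $Y$ are isomorphic if there are bijections of the node sets and of the edge sets compatible with $i,o,s,t,\ell$. Let $\mathrm{Circ}_L$ be the prop whose morphisms $m \to n$ are isomorphism classes of $L$-circuits from $\{0,\dots,m-1\}$ to $\{0,\dots,n-1\}$; cospans are composed by pushout over the common set $Y$, the composite graph having edge set $E+E'$ with sources and targets carried to $N+_Y N'$ and labels kept, and the tensor product is disjoint union. Let $\mathrm{FinCospan}$ be the prop whose morphisms $m\to n$ are isomorphism classes of cospans of finite sets from $\{0,\dots,m-1\}$ to $\{0,\dots,n-1\}$, composed by pushout and tensored by disjoint union. Let $F(L)$, the prop for $L$-actions, be the free prop generated by one morphism $\ell\colon 1\to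 1$ for each $\ell\in L$. Then $\mathrm{Circ}_L$ is the coproduct of $\mathrm{FinCospan}$ and $F(L)$ in $\mathrm{PROP}$, so $\mathrm{Circ}_L\cong \mathrm{FinCospan}+F(L)$. The coprojection $\mathrm{FinCospan}\to \mathrm{Circ}_L$ regards a cospan as an $L$-circuit with no edges, and the coprojection $F(L)\to\mathrm{Circ}_L$ sends the generator $\ell$ to the $L$-circuit with two nodes (one the input, the other the output) and a single edge, labelled $\ell$, from the input to the output. -/

import Mathlib

open CategoryTheory

universe u v w

/-! ## Props -/

/-- Transport of a morphism `m ⟶ n` along equalities of the objects `m` and `n`. -/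
def castHom {H : ℕ → ℕ → Type v} {m m' n n' : ℕ} (hm : m = m') (hn : n = n') (f : H m n) :
    H m' n' :=
  hn ▸ hm ▸ f

/-- A prop: a strict symmetric monoidal category whose objects are the natural numbers, the tensor
product of objects being addition.  Composition is written in diagrammatic order. -/
structure PropCat : Type (v + 1) where
  hom : ℕ → ℕ → Type v
  id : ∀ m, hom m m
  comp : ∀ {l m n}, hom l m → hom m n → hom l n
  tensor : ∀ {m n m' n'}, hom m n → hom m' n' → hom (m + m') (n + n')
  braid : ∀ m n, hom (m + n) (n + m)
  id_comp : ∀ {m n} (f : hom m n), comp (id m) f = f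
  comp_id : ∀ {m n} (f : hom m n), comp f (id n) = f
  assoc : ∀ {k l m n} (f : hom k l) (g : hom l m) (h : hom m n),
    comp (comp f g) h = comp f (comp g h)
  tensor_id : ∀ m n, tensor (id m) (id n) = id (m + n)
  tensor_comp : ∀ {l m n l' m' n'} (f : hom l m) (g : hom m n) (f' : hom l' m') (g' : hom m' n'),
    tensor (comp f g) (comp f' g') = comp (tensor f f') (tensor g g')
  tensor_assoc : ∀ {m n m' n' m'' n''} (f : hom m n) (g : hom m' n') (h : hom m'' n''),
    castHom (Nat.add_assoc _ _ _) (Nat.add_assoc _ _ _) (tensor (tensor f g) h) =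
      tensor f (tensor g h)
  id_zero_tensor : ∀ {m n} (f : hom m n),
    castHom (Nat.zero_add _) (Nat.zero_add _) (tensor (id 0) f) = f
  tensor_id_zero : ∀ {m n} (f : hom m n),
    castHom (Nat.add_zero _) (Nat.add_zero _) (tensor f (id 0)) = f
  braid_naturality : ∀ {m n m' n'} (f : hom m n) (g : hom m' n'),
    comp (tensor f g) (braid n n') = comp (braid m m') (tensor g f)
  braid_symm : ∀ m n, comp (braid m n) (braid n m) = id (m + n)
  braid_zero : ∀ n, castHom (Nat.zero_add _) (Nat.add_zero _) (braid 0 n) = id n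
  hexagon : ∀ l m n,
    castHom (Nat.add_assoc l m n) (Nat.add_assoc m n l).symm
      (comp (tensor (braid l m) (id n))
        (castHom (Nat.add_assoc m l n).symm rfl (tensor (id m) (braid l n)))) =
      braid l (m + n)

namespace PropCat

/-- A morphism of props: a strict symmetric monoidal functor that is the identity on objects. -/
@[ext]
structure Hom (P Q : PropCat.{v}) : Type v where
  map : ∀ {m n}, P.hom m n → Q.hom m n
  map_id : ∀ m, map (P.id m) = Q.id m
  map_comp : ∀ {l m n} (f : P.hom l m) (g : P.hom m n), map (P.comp f g) = Q.comp (map f) (map g)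
  map_tensor : ∀ {m n m' n'} (f : P.hom m n) (g : P.hom m' n'),
    map (P.tensor f g) = Q.tensor (map f) (map g)
  map_braid : ∀ m n, map (P.braid m n) = Q.braid m n

/-- The category of props. -/
instance : Category PropCat.{v} where
  Hom P Q := Hom P Q
  id P :=
    { map := fun f => f
      map_id := fun _ => rfl
      map_comp := fun _ _ => rfl
      map_tensor := fun _ _ => rfl
      map_braid := fun _ _ => rfl }
  comp F G :=
    { map := fun f => G.map (F.map f)
      map_id := fun m => by rw [F.map_id, G.map_id]
      map_comp := fun f g => by rw [F.map_comp, G.map_comp]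
      map_tensor := fun f g => by rw [F.map_tensor, G.map_tensor]
      map_braid := fun m n => by rw [F.map_braid, G.map_braid] }
  id_comp _ := rfl
  comp_id _ := rfl
  assoc _ _ _ := rfl

end PropCat

/-! ## Free props -/

namespace FreeProp

/-- Formal prop expressions in the operations of a signature `S`, where `S m n` is the set of
operations with `m` inputs and `n` outputs. -/
inductive Term (S : ℕ → ℕ → Type v) : ℕ → ℕ → Type v
  | gen {m n : ℕ} (x : S m n) : Term S m n
  | id (m : ℕ) : Term S m m
  | comp {l m n : ℕ} (f : Term S l m) (g : Term S m n) : Term S l n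
  | tensor {m n m' n' : ℕ} (f : Term S m n) (g : Term S m' n') : Term S (m + m') (n + n')
  | braid (m n : ℕ) : Term S (m + n) (n + m)

open Term in
/-- The congruence on expressions generated by the laws of a prop. -/
inductive Rel (S : ℕ → ℕ → Type v) : ∀ {m n : ℕ}, Term S m n → Term S m n → Prop
  | refl {m n : ℕ} (f : Term S m n) : Rel S f f
  | symm {m n : ℕ} {f g : Term S m n} : Rel S f g → Rel S g f
  | trans {m n : ℕ} {f g h : Term S m n} : Rel S f g → Rel S g h → Rel S f h
  | comp_congr {l m n : ℕ} {f f' : Term S l m} {g g' : Term S m n} :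
      Rel S f f' → Rel S g g' → Rel S (comp f g) (comp f' g')
  | tensor_congr {m n m' n' : ℕ} {f f' : Term S m n} {g g' : Term S m' n'} :
      Rel S f f' → Rel S g g' → Rel S (tensor f g) (tensor f' g')
  | id_comp {m n : ℕ} (f : Term S m n) : Rel S (comp (id m) f) f
  | comp_id {m n : ℕ} (f : Term S m n) : Rel S (comp f (id n)) f
  | assoc {k l m n : ℕ} (f : Term S k l) (g : Term S l m) (h : Term S m n) :
      Rel S (comp (comp f g) h) (comp f (comp g h))
  | tensor_id (m n : ℕ) : Rel S (tensor (id m) (id n)) (id (m + n))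
  | tensor_comp {l m n l' m' n' : ℕ} (f : Term S l m) (g : Term S m n) (f' : Term S l' m')
      (g' : Term S m' n') :
      Rel S (tensor (comp f g) (comp f' g')) (comp (tensor f f') (tensor g g'))
  | tensor_assoc {m n m' n' m'' n'' : ℕ} (f : Term S m n) (g : Term S m' n')
      (h : Term S m'' n'') :
      Rel S (castHom (Nat.add_assoc _ _ _) (Nat.add_assoc _ _ _) (tensor (tensor f g) h))
        (tensor f (tensor g h))
  | id_zero_tensor {m n : ℕ} (f : Term S m n) :
      Rel S (castHom (Nat.zero_add _) (Nat.zero_add _) (tensor (id 0) f)) f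
  | tensor_id_zero {m n : ℕ} (f : Term S m n) :
      Rel S (castHom (Nat.add_zero _) (Nat.add_zero _) (tensor f (id 0))) f
  | braid_naturality {m n m' n' : ℕ} (f : Term S m n) (g : Term S m' n') :
      Rel S (comp (tensor f g) (braid n n')) (comp (braid m m') (tensor g f))
  | braid_symm (m n : ℕ) : Rel S (comp (braid m n) (braid n m)) (id (m + n))
  | braid_zero (n : ℕ) :
      Rel S (castHom (Nat.zero_add _) (Nat.add_zero _) (braid 0 n)) (id n)
  | hexagon (l m n : ℕ) :
      Rel S (castHom (Nat.add_assoc l m n) (Nat.add_assoc m n l).symm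
        (comp (tensor (braid l m) (id n))
          (castHom (Nat.add_assoc m l n).symm rfl (tensor (id m) (braid l n)))))
        (braid l (m + n))

/-- The setoid of provable equality of expressions. -/
def termSetoid (S : ℕ → ℕ → Type v) (m n : ℕ) : Setoid (Term S m n) where
  r := Rel S
  iseqv := ⟨Rel.refl, Rel.symm, Rel.trans⟩

/-- Morphisms of the free prop: expressions modulo the laws of a prop. -/
def Mor (S : ℕ → ℕ → Type v) (m n : ℕ) : Type v := Quotient (termSetoid S m n)

/-- The class of an expression. -/
def mk {S : ℕ → ℕ → Type v} {m n : ℕ} (f : Term S m n) : Mor S m n :=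
  Quotient.mk (termSetoid S m n) f

theorem mk_eq {S : ℕ → ℕ → Type v} {m n : ℕ} {f g : Term S m n} (h : Rel S f g) : mk f = mk g :=
  Quotient.sound h

theorem mk_surj {S : ℕ → ℕ → Type v} {m n : ℕ} (f : Mor S m n) : ∃ t, mk t = f :=
  Quotient.exists_rep f

theorem castHom_mk {S : ℕ → ℕ → Type v} {m m' n n' : ℕ} (hm : m = m') (hn : n = n')
    (f : Term S m n) : castHom (H := Mor S) hm hn (mk f) = mk (castHom hm hn f) := by
  subst hm hn; rfl

/-- Composition of classes. -/
def Mor.comp {S : ℕ → ℕ → Type v} {l m n : ℕ} (f : Mor S l m) (g : Mor S m n) : Mor S l n :=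
  Quotient.map₂ Term.comp (fun _ _ h _ _ h' => Rel.comp_congr h h') f g

/-- Tensor product of classes. -/
def Mor.tensor {S : ℕ → ℕ → Type v} {m n m' n' : ℕ} (f : Mor S m n) (g : Mor S m' n') :
    Mor S (m + m') (n + n') :=
  Quotient.map₂ Term.tensor (fun _ _ h _ _ h' => Rel.tensor_congr h h') f g

theorem comp_mk {S : ℕ → ℕ → Type v} {l m n : ℕ} (f : Term S l m) (g : Term S m n) :
    (mk f).comp (mk g) = mk (f.comp g) := rfl

theorem tensor_mk {S : ℕ → ℕ → Type v} {m n m' n' : ℕ} (f : Term S m n) (g : Term S m' n') :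
    (mk f).tensor (mk g) = mk (f.tensor g) := rfl

end FreeProp

open FreeProp in
/-- The free prop on a signature. -/
def FreeProp (S : ℕ → ℕ → Type v) : PropCat.{v} where
  hom := Mor S
  id m := mk (.id m)
  comp := Mor.comp
  tensor := Mor.tensor
  braid m n := mk (.braid m n)
  id_comp f := by
    obtain ⟨f, rfl⟩ := mk_surj f
    exact mk_eq (.id_comp f)
  comp_id f := by
    obtain ⟨f, rfl⟩ := mk_surj f
    exact mk_eq (.comp_id f)
  assoc f g h := by
    obtain ⟨f, rfl⟩ := mk_surj f
    obtain ⟨g, rfl⟩ := mk_surj g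
    obtain ⟨h, rfl⟩ := mk_surj h
    exact mk_eq (.assoc f g h)
  tensor_id m n := mk_eq (.tensor_id m n)
  tensor_comp f g f' g' := by
    obtain ⟨f, rfl⟩ := mk_surj f
    obtain ⟨g, rfl⟩ := mk_surj g
    obtain ⟨f', rfl⟩ := mk_surj f'
    obtain ⟨g', rfl⟩ := mk_surj g'
    exact mk_eq (.tensor_comp f g f' g')
  tensor_assoc f g h := by
    obtain ⟨f, rfl⟩ := mk_surj f
    obtain ⟨g, rfl⟩ := mk_surj g
    obtain ⟨h, rfl⟩ := mk_surj h
    simp only [tensor_mk, castHom_mk]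
    exact mk_eq (.tensor_assoc f g h)
  id_zero_tensor f := by
    obtain ⟨f, rfl⟩ := mk_surj f
    simp only [tensor_mk, castHom_mk]
    exact mk_eq (.id_zero_tensor f)
  tensor_id_zero f := by
    obtain ⟨f, rfl⟩ := mk_surj f
    simp only [tensor_mk, castHom_mk]
    exact mk_eq (.tensor_id_zero f)
  braid_naturality f g := by
    obtain ⟨f, rfl⟩ := mk_surj f
    obtain ⟨g, rfl⟩ := mk_surj g
    exact mk_eq (.braid_naturality f g)
  braid_symm m n := mk_eq (.braid_symm m n)
  braid_zero n := by
    simp only [castHom_mk]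
    exact mk_eq (.braid_zero n)
  hexagon l m n := by
    simp only [tensor_mk, castHom_mk, comp_mk]
    exact mk_eq (.hexagon l m n)

namespace FreeProp

/-- Evaluation of expressions in a prop. -/
def eval {S : ℕ → ℕ → Type v} (P : PropCat.{w}) (φ : ∀ m n, S m n → P.hom m n) :
    ∀ {m n : ℕ}, Term S m n → P.hom m n
  | _, _, .gen x => φ _ _ x
  | _, _, .id m => P.id m
  | _, _, .comp f g => P.comp (eval P φ f) (eval P φ g)
  | _, _, .tensor f g => P.tensor (eval P φ f) (eval P φ g)
  | _, _, .braid m n => P.braid m n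

theorem eval_castHom {S : ℕ → ℕ → Type v} (P : PropCat.{w}) (φ : ∀ m n, S m n → P.hom m n)
    {m m' n n' : ℕ} (hm : m = m') (hn : n = n') (f : Term S m n) :
    eval P φ (castHom hm hn f) = castHom hm hn (eval P φ f) := by
  subst hm hn; rfl

theorem eval_rel {S : ℕ → ℕ → Type v} (P : PropCat.{w}) (φ : ∀ m n, S m n → P.hom m n)
    {m n : ℕ} {f g : Term S m n} (h : Rel S f g) : eval P φ f = eval P φ g := by
  induction h with
  | refl f => rfl
  | symm _ ih => exact ih.symm
  | trans _ _ ih ih' => exact ih.trans ih'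
  | comp_congr _ _ ih ih' => simp only [eval, ih, ih']
  | tensor_congr _ _ ih ih' => simp only [eval, ih, ih']
  | id_comp f => exact P.id_comp _
  | comp_id f => exact P.comp_id _
  | assoc f g h => exact P.assoc _ _ _
  | tensor_id m n => exact P.tensor_id m n
  | tensor_comp f g f' g' => exact P.tensor_comp _ _ _ _
  | tensor_assoc f g h => rw [eval_castHom]; exact P.tensor_assoc _ _ _
  | id_zero_tensor f => rw [eval_castHom]; exact P.id_zero_tensor _
  | tensor_id_zero f => rw [eval_castHom]; exact P.tensor_id_zero _
  | braid_naturality f g => exact P.braid_naturality _ _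
  | braid_symm m n => exact P.braid_symm m n
  | braid_zero n => rw [eval_castHom]; exact P.braid_zero n
  | hexagon l m n =>
    rw [eval_castHom]
    simp only [eval, eval_castHom]
    exact P.hexagon l m n

/-- The morphism out of a free prop determined by its values on the generators. -/
def lift {S : ℕ → ℕ → Type v} {P : PropCat.{v}} (φ : ∀ m n, S m n → P.hom m n) :
    FreeProp S ⟶ P :=
  show PropCat.Hom (FreeProp S) P from
  { map := fun f => Quotient.lift (eval P φ) (fun _ _ h => eval_rel P φ h) f
    map_id := fun _ => rfl
    map_comp := fun f g => by
      obtain ⟨f, rfl⟩ := mk_surj f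
      obtain ⟨g, rfl⟩ := mk_surj g
      rfl
    map_tensor := fun f g => by
      obtain ⟨f, rfl⟩ := mk_surj f
      obtain ⟨g, rfl⟩ := mk_surj g
      rfl
    map_braid := fun _ _ => rfl }

end FreeProp

/-- The signature with one operation `1 ⟶ 1` for each element of `L`, and no other operations. -/
inductive UnarySig (L : Type u) : ℕ → ℕ → Type (u + 1)
  | op (ℓ : L) : UnarySig L 1 1

/-- The prop for `L`-actions: the free prop with one morphism `1 ⟶ 1` for each label. -/
def ActionProp (L : Type u) : PropCat.{u + 1} := FreeProp (UnarySig L)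

/-! ## Pushouts of sets -/

/-- The pushout `N +_Y N'` of two functions `o : Y → N` and `i : Y → N'`. -/
def SetPushout {Y : Type w} {N N' : Type u} (o : Y → N) (i : Y → N') : Type u :=
  Quot (fun a b : N ⊕ N' => ∃ y, a = Sum.inl (o y) ∧ b = Sum.inr (i y))

namespace SetPushout

variable {Y : Type w} {N N' : Type u} {o : Y → N} {i : Y → N'}

instance [Finite N] [Finite N'] : Finite (SetPushout o i) := by
  unfold SetPushout; infer_instance

/-- The natural map `j : N + N' → N +_Y N'`. -/
def proj (o : Y → N) (i : Y → N') (a : N ⊕ N') : SetPushout o i := Quot.mk _ a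

theorem glue (y : Y) : proj o i (Sum.inl (o y)) = proj o i (Sum.inr (i y)) :=
  Quot.sound ⟨y, rfl, rfl⟩

/-- The universal property of the pushout. -/
def desc {Z : Type v} (f : N → Z) (g : N' → Z) (h : ∀ y, f (o y) = g (i y)) :
    SetPushout o i → Z :=
  Quot.lift (Sum.elim f g) (by rintro _ _ ⟨y, rfl, rfl⟩; exact h y)

@[simp] theorem desc_inl {Z : Type v} (f : N → Z) (g : N' → Z) (h : ∀ y, f (o y) = g (i y))
    (a : N) : desc f g h (proj o i (Sum.inl a)) = f a := rfl

@[simp] theorem desc_inr {Z : Type v} (f : N → Z) (g : N' → Z) (h : ∀ y, f (o y) = g (i y))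
    (a : N') : desc f g h (proj o i (Sum.inr a)) = g a := rfl

theorem ind {p : SetPushout o i → Prop} (hl : ∀ a, p (proj o i (Sum.inl a)))
    (hr : ∀ a, p (proj o i (Sum.inr a))) (x : SetPushout o i) : p x := by
  rcases x with ⟨a | a⟩
  · exact hl a
  · exact hr a

end SetPushout

/-! ## Cospans of finite sets and circuits -/

/-- A cospan `X → N ← Y` with finite apex `N`. -/
structure Cospan (X Y : Type) : Type (u + 1) where
  nodes : Type u
  [finite_nodes : Finite nodes]
  i : X → nodes
  o : Y → nodes

/-- An `L`-circuit from `X` to `Y`: a cospan `X → N ← Y` together with a finite `L`-labelled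
directed multigraph `s, t : E → N`, `label : E → L` on its apex. -/
structure Circuit (L : Type u) (X Y : Type) : Type (u + 1) extends Cospan.{u} X Y where
  edges : Type u
  [finite_edges : Finite edges]
  s : edges → nodes
  t : edges → nodes
  label : edges → L

attribute [instance] Cospan.finite_nodes Circuit.finite_edges

/-- An isomorphism of cospans. -/
structure Cospan.Iso {X Y : Type} (c c' : Cospan.{u} X Y) where
  node : c.nodes ≃ c'.nodes
  i_eq : ∀ x, node (c.i x) = c'.i x
  o_eq : ∀ y, node (c.o y) = c'.o y

/-- An isomorphism of circuits. -/
structure Circuit.Iso {L : Type u} {X Y : Type} (c c' : Circuit L X Y) extends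
    Cospan.Iso c.toCospan c'.toCospan where
  edge : c.edges ≃ c'.edges
  s_eq : ∀ e, node (c.s e) = c'.s (edge e)
  t_eq : ∀ e, node (c.t e) = c'.t (edge e)
  label_eq : ∀ e, c'.label (edge e) = c.label e

/-- Cospans up to isomorphism. -/
def cospanSetoid (X Y : Type) : Setoid (Cospan.{u} X Y) where
  r c c' := Nonempty (c.Iso c')
  iseqv :=
    { refl := fun c => ⟨⟨Equiv.refl _, fun _ => rfl, fun _ => rfl⟩⟩
      symm := by
        rintro c c' ⟨f⟩
        exact ⟨⟨f.node.symm, fun x => by rw [← f.i_eq, Equiv.symm_apply_apply],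
          fun x => by rw [← f.o_eq, Equiv.symm_apply_apply]⟩⟩
      trans := by
        rintro c c' c'' ⟨f⟩ ⟨g⟩
        exact ⟨⟨f.node.trans g.node, fun x => by simp [f.i_eq, g.i_eq],
          fun x => by simp [f.o_eq, g.o_eq]⟩⟩ }

/-- Circuits up to isomorphism. -/
def circuitSetoid (L : Type u) (X Y : Type) : Setoid (Circuit L X Y) where
  r c c' := Nonempty (c.Iso c')
  iseqv :=
    { refl := fun c => ⟨⟨⟨Equiv.refl _, fun _ => rfl, fun _ => rfl⟩, Equiv.refl _,
        fun _ => rfl, fun _ => rfl, fun _ => rfl⟩⟩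
      symm := by
        rintro c c' ⟨f⟩
        refine ⟨⟨⟨f.node.symm, fun x => ?_, fun x => ?_⟩, f.edge.symm,
          fun e => ?_, fun e => ?_, fun e => ?_⟩⟩
        · rw [← f.i_eq, Equiv.symm_apply_apply]
        · rw [← f.o_eq, Equiv.symm_apply_apply]
        · rw [Equiv.symm_apply_eq, f.s_eq, Equiv.apply_symm_apply]
        · rw [Equiv.symm_apply_eq, f.t_eq, Equiv.apply_symm_apply]
        · rw [← f.label_eq, Equiv.apply_symm_apply]
      trans := by
        rintro c c' c'' ⟨f⟩ ⟨g⟩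
        exact ⟨⟨⟨f.node.trans g.node, fun x => by simp [f.i_eq, g.i_eq],
          fun x => by simp [f.o_eq, g.o_eq]⟩, f.edge.trans g.edge,
          fun e => by simp [f.s_eq, g.s_eq], fun e => by simp [f.t_eq, g.t_eq],
          fun e => by simp [f.label_eq, g.label_eq]⟩⟩ }

namespace Cospan

/-- Precomposition of the two legs with functions. -/
def reindex {X Y X' Y' : Type} (c : Cospan.{u} X Y) (f : X' → X) (g : Y' → Y) :
    Cospan.{u} X' Y' where
  nodes := c.nodes
  i x := c.i (f x)
  o y := c.o (g y)

/-- The identity cospan. -/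
def id (X : Type) [Finite X] : Cospan.{u} X X where
  nodes := ULift.{u} X
  i := ULift.up
  o := ULift.up

/-- Composition of cospans by pushout. -/
def comp {X Y Z : Type} (c : Cospan.{u} X Y) (d : Cospan.{u} Y Z) : Cospan.{u} X Z where
  nodes := SetPushout c.o d.i
  i x := SetPushout.proj _ _ (Sum.inl (c.i x))
  o z := SetPushout.proj _ _ (Sum.inr (d.o z))

/-- Tensor product of cospans by disjoint union. -/
def tensor {X Y X' Y' : Type} (c : Cospan.{u} X Y) (d : Cospan.{u} X' Y') :
    Cospan.{u} (X ⊕ X') (Y ⊕ Y') where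
  nodes := c.nodes ⊕ d.nodes
  i := Sum.map c.i d.i
  o := Sum.map c.o d.o

/-- The braiding `X + Y → X + Y ← Y + X`. -/
def braid (X Y : Type) [Finite X] [Finite Y] : Cospan.{u} (X ⊕ Y) (Y ⊕ X) where
  nodes := ULift.{u} (X ⊕ Y)
  i := ULift.up
  o z := ULift.up z.swap

/-- A cospan regarded as a circuit with no edges. -/
def toCircuit (L : Type u) {X Y : Type} (c : Cospan.{u} X Y) : Circuit L X Y where
  toCospan := c
  edges := PEmpty
  s := PEmpty.elim
  t := PEmpty.elim
  label := PEmpty.elim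

end Cospan

namespace Circuit

variable {L : Type u}

/-- Precomposition of the two legs with functions. -/
def reindex {X Y X' Y' : Type} (c : Circuit L X Y) (f : X' → X) (g : Y' → Y) :
    Circuit L X' Y' where
  toCospan := c.toCospan.reindex f g
  edges := c.edges
  s := c.s
  t := c.t
  label := c.label

/-- Composition of circuits: the underlying cospans are composed by pushout, and the edges of both
circuits are kept. -/
def comp {X Y Z : Type} (c : Circuit L X Y) (d : Circuit L Y Z) : Circuit L X Z where
  toCospan := c.toCospan.comp d.toCospan
  edges := c.edges ⊕ d.edges
  s e := SetPushout.proj c.o d.i (Sum.map c.s d.s e)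
  t e := SetPushout.proj c.o d.i (Sum.map c.t d.t e)
  label := Sum.elim c.label d.label

/-- Tensor product of circuits by disjoint union. -/
def tensor {X Y X' Y' : Type} (c : Circuit L X Y) (d : Circuit L X' Y') :
    Circuit L (X ⊕ X') (Y ⊕ Y') where
  toCospan := c.toCospan.tensor d.toCospan
  edges := c.edges ⊕ d.edges
  s := Sum.map c.s d.s
  t := Sum.map c.t d.t
  label := Sum.elim c.label d.label

/-- The circuit consisting of one edge labelled `ℓ` from the single input to the single output. -/
def edge (ℓ : L) : Circuit L (Fin 1) (Fin 1) where
  nodes := PUnit.{u + 1} ⊕ PUnit.{u + 1}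
  i _ := Sum.inl PUnit.unit
  o _ := Sum.inr PUnit.unit
  edges := PUnit
  s _ := Sum.inl PUnit.unit
  t _ := Sum.inr PUnit.unit
  label _ := ℓ

end Circuit

/-! ## Operations on isomorphism classes -/

namespace Circuit

variable {L : Type u}

theorem comp_congr {X Y Z : Type} {c c' : Circuit L X Y} {d d' : Circuit L Y Z}
    (h : Nonempty (c.Iso c')) (h' : Nonempty (d.Iso d')) :
    Nonempty ((c.comp d).Iso (c'.comp d')) := by
  obtain ⟨f⟩ := h
  obtain ⟨g⟩ := h'
  refine ⟨⟨⟨⟨SetPushout.desc (fun a => SetPushout.proj _ _ (Sum.inl (f.node a)))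
      (fun a => SetPushout.proj _ _ (Sum.inr (g.node a))) ?_,
    SetPushout.desc (fun a => SetPushout.proj _ _ (Sum.inl (f.node.symm a)))
      (fun a => SetPushout.proj _ _ (Sum.inr (g.node.symm a))) ?_, ?_, ?_⟩, ?_, ?_⟩,
    Equiv.sumCongr f.edge g.edge, ?_, ?_, ?_⟩⟩
  · intro y; rw [f.o_eq, g.i_eq]; exact SetPushout.glue y
  · intro y; rw [← f.o_eq, ← g.i_eq, Equiv.symm_apply_apply, Equiv.symm_apply_apply]
    exact SetPushout.glue y
  · refine SetPushout.ind (fun a => ?_) (fun a => ?_)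
    · exact congrArg (fun z => SetPushout.proj _ _ (Sum.inl z)) (f.node.symm_apply_apply a)
    · exact congrArg (fun z => SetPushout.proj _ _ (Sum.inr z)) (g.node.symm_apply_apply a)
  · refine SetPushout.ind (fun a => ?_) (fun a => ?_)
    · exact congrArg (fun z => SetPushout.proj _ _ (Sum.inl z)) (f.node.apply_symm_apply a)
    · exact congrArg (fun z => SetPushout.proj _ _ (Sum.inr z)) (g.node.apply_symm_apply a)
  · intro x
    change SetPushout.proj _ _ (Sum.inl (f.node (c.i x))) = _
    rw [f.i_eq]; rfl
  · intro x
    change SetPushout.proj _ _ (Sum.inr (g.node (d.o x))) = _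
    rw [g.o_eq]; rfl
  · rintro (e | e)
    · change SetPushout.proj _ _ (Sum.inl (f.node (c.s e))) = _
      rw [f.s_eq]; rfl
    · change SetPushout.proj _ _ (Sum.inr (g.node (d.s e))) = _
      rw [g.s_eq]; rfl
  · rintro (e | e)
    · change SetPushout.proj _ _ (Sum.inl (f.node (c.t e))) = _
      rw [f.t_eq]; rfl
    · change SetPushout.proj _ _ (Sum.inr (g.node (d.t e))) = _
      rw [g.t_eq]; rfl
  · rintro (e | e)
    · exact f.label_eq e
    · exact g.label_eq e

theorem tensor_congr {X Y X' Y' : Type} {c c' : Circuit L X Y} {d d' : Circuit L X' Y'}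
    (h : Nonempty (c.Iso c')) (h' : Nonempty (d.Iso d')) :
    Nonempty ((c.tensor d).Iso (c'.tensor d')) := by
  obtain ⟨f⟩ := h
  obtain ⟨g⟩ := h'
  refine ⟨⟨⟨Equiv.sumCongr f.node g.node, ?_, ?_⟩, Equiv.sumCongr f.edge g.edge, ?_, ?_, ?_⟩⟩
  · rintro (x | x)
    · exact congrArg Sum.inl (f.i_eq x)
    · exact congrArg Sum.inr (g.i_eq x)
  · rintro (x | x)
    · exact congrArg Sum.inl (f.o_eq x)
    · exact congrArg Sum.inr (g.o_eq x)
  · rintro (x | x)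
    · exact congrArg Sum.inl (f.s_eq x)
    · exact congrArg Sum.inr (g.s_eq x)
  · rintro (x | x)
    · exact congrArg Sum.inl (f.t_eq x)
    · exact congrArg Sum.inr (g.t_eq x)
  · rintro (x | x)
    · exact f.label_eq x
    · exact g.label_eq x

theorem reindex_congr {X Y X' Y' : Type} {c c' : Circuit L X Y} (f : X' → X) (g : Y' → Y)
    (h : Nonempty (c.Iso c')) : Nonempty ((c.reindex f g).Iso (c'.reindex f g)) := by
  obtain ⟨k⟩ := h
  exact ⟨⟨⟨k.node, fun x => k.i_eq _, fun y => k.o_eq _⟩, k.edge, k.s_eq, k.t_eq, k.label_eq⟩⟩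

end Circuit

namespace Cospan

theorem toCircuit_congr (L : Type u) {X Y : Type} {c c' : Cospan.{u} X Y}
    (h : Nonempty (c.Iso c')) : Nonempty ((c.toCircuit L).Iso (c'.toCircuit L)) := by
  obtain ⟨f⟩ := h
  exact ⟨⟨f, Equiv.refl _, fun e => e.elim, fun e => e.elim, fun e => e.elim⟩⟩

theorem toCircuit_comp (L : Type u) {X Y Z : Type} (c : Cospan.{u} X Y) (d : Cospan.{u} Y Z) :
    Nonempty (((c.comp d).toCircuit L).Iso ((c.toCircuit L).comp (d.toCircuit L))) :=
  ⟨⟨⟨Equiv.refl _, fun _ => rfl, fun _ => rfl⟩,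
    ⟨fun e => e.elim, fun e => e.elim (fun e => e) (fun e => e), fun e => e.elim, fun e => e.elim (fun e => e.elim)
      (fun e => e.elim)⟩, fun e => e.elim, fun e => e.elim, fun e => e.elim⟩⟩

theorem toCircuit_tensor (L : Type u) {X Y X' Y' : Type} (c : Cospan.{u} X Y)
    (d : Cospan.{u} X' Y') :
    Nonempty (((c.tensor d).toCircuit L).Iso ((c.toCircuit L).tensor (d.toCircuit L))) :=
  ⟨⟨⟨Equiv.refl _, fun _ => rfl, fun _ => rfl⟩,
    ⟨fun e => e.elim, fun e => e.elim (fun e => e) (fun e => e), fun e => e.elim, fun e => e.elim (fun e => e.elim)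
      (fun e => e.elim)⟩, fun e => e.elim, fun e => e.elim, fun e => e.elim⟩⟩

theorem comp_congr {X Y Z : Type} {c c' : Cospan.{u} X Y} {d d' : Cospan.{u} Y Z}
    (h : Nonempty (c.Iso c')) (h' : Nonempty (d.Iso d')) :
    Nonempty ((c.comp d).Iso (c'.comp d')) := by
  obtain ⟨f⟩ := Circuit.comp_congr (toCircuit_congr PEmpty h) (toCircuit_congr PEmpty h')
  exact ⟨f.toIso⟩

theorem tensor_congr {X Y X' Y' : Type} {c c' : Cospan.{u} X Y} {d d' : Cospan.{u} X' Y'}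
    (h : Nonempty (c.Iso c')) (h' : Nonempty (d.Iso d')) :
    Nonempty ((c.tensor d).Iso (c'.tensor d')) := by
  obtain ⟨f⟩ := Circuit.tensor_congr (toCircuit_congr PEmpty h) (toCircuit_congr PEmpty h')
  exact ⟨f.toIso⟩

theorem reindex_congr {X Y X' Y' : Type} {c c' : Cospan.{u} X Y} (f : X' → X) (g : Y' → Y)
    (h : Nonempty (c.Iso c')) : Nonempty ((c.reindex f g).Iso (c'.reindex f g)) := by
  obtain ⟨k⟩ := h
  exact ⟨⟨k.node, fun x => k.i_eq _, fun y => k.o_eq _⟩⟩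

end Cospan

/-- Isomorphism classes of `L`-circuits from an `m`-element set to an `n`-element set. -/
def CircuitClass (L : Type u) (m n : ℕ) : Type (u + 1) :=
  Quotient (circuitSetoid L (Fin m) (Fin n))

namespace CircuitClass

variable {L : Type u}

/-- The isomorphism class of a circuit. -/
def mk {m n : ℕ} (c : Circuit L (Fin m) (Fin n)) : CircuitClass L m n :=
  Quotient.mk (circuitSetoid L (Fin m) (Fin n)) c

theorem mk_eq {m n : ℕ} {c d : Circuit L (Fin m) (Fin n)} (h : Nonempty (c.Iso d)) :
    mk c = mk d :=
  Quotient.sound h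

theorem mk_exact {m n : ℕ} {c d : Circuit L (Fin m) (Fin n)} (h : mk c = mk d) :
    Nonempty (c.Iso d) :=
  Quotient.exact h

theorem mk_surj {m n : ℕ} (c : CircuitClass L m n) : ∃ d, mk d = c :=
  Quotient.exists_rep c

/-- The identity morphism. -/
def id (L : Type u) (m : ℕ) : CircuitClass L m m := mk ((Cospan.id (Fin m)).toCircuit L)

/-- Composition of classes. -/
def comp {l m n : ℕ} (f : CircuitClass L l m) (g : CircuitClass L m n) : CircuitClass L l n :=
  Quotient.map₂ Circuit.comp (fun _ _ h _ _ h' => Circuit.comp_congr h h') f g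

/-- Tensor product of classes, identifying the set `m + m'` with the disjoint union of `m` and
`m'`. -/
def tensor {m n m' n' : ℕ} (f : CircuitClass L m n) (g : CircuitClass L m' n') :
    CircuitClass L (m + m') (n + n') :=
  Quotient.map₂
    (fun c d => (Circuit.tensor c d).reindex finSumFinEquiv.symm finSumFinEquiv.symm)
    (fun _ _ h _ _ h' => Circuit.reindex_congr _ _ (Circuit.tensor_congr h h')) f g

/-- The braiding. -/
def braid (L : Type u) (m n : ℕ) : CircuitClass L (m + n) (n + m) :=
  mk (((Cospan.braid (Fin m) (Fin n)).reindex
    finSumFinEquiv.symm finSumFinEquiv.symm).toCircuit L)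

theorem comp_mk {l m n : ℕ} (c : Circuit L (Fin l) (Fin m)) (d : Circuit L (Fin m) (Fin n)) :
    (mk c).comp (mk d) = mk (c.comp d) := rfl

theorem tensor_mk {m n m' n' : ℕ} (c : Circuit L (Fin m) (Fin n))
    (d : Circuit L (Fin m') (Fin n')) :
    (mk c).tensor (mk d) =
      mk ((c.tensor d).reindex finSumFinEquiv.symm finSumFinEquiv.symm) := rfl

theorem castHom_mk {m m' n n' : ℕ} (hm : m = m') (hn : n = n') (c : Circuit L (Fin m) (Fin n)) :
    castHom (H := CircuitClass L) hm hn (mk c) =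
      mk (c.reindex (Fin.cast hm.symm) (Fin.cast hn.symm)) := by
  subst hm hn; rfl

/-- Precomposing with a bijection, regarded as a circuit without edges, reindexes the inputs. -/
theorem perm_comp {m n : ℕ} {X : Type} [Finite X] (a : Fin m ≃ X) (b : Fin n ≃ X) {k : ℕ}
    (c : Circuit L (Fin n) (Fin k)) :
    (mk (((Cospan.id X).reindex a b).toCircuit L)).comp (mk c) =
      mk (c.reindex (fun x => b.symm (a x)) (fun y => y)) := by
  refine mk_eq ⟨⟨⟨⟨SetPushout.desc (fun z => c.i (b.symm z.down)) (fun z => z) ?_,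
    fun z => SetPushout.proj _ _ (Sum.inr z), ?_, ?_⟩, ?_, ?_⟩,
    ⟨Sum.elim (fun e => e.elim) (fun e => e), Sum.inr, ?_, ?_⟩, ?_, ?_, ?_⟩⟩
  · intro y
    change c.i (b.symm (b y)) = c.i y
    rw [Equiv.symm_apply_apply]
  · refine SetPushout.ind (fun z => ?_) (fun z => rfl)
    have := SetPushout.glue (o := (((Cospan.id.{u} X).reindex a b).toCircuit L).o) (i := c.i)
      (b.symm z.down)
    refine Eq.trans this.symm ?_
    congr 2
    change ULift.up (b (b.symm z.down)) = z
    rw [Equiv.apply_symm_apply]; rfl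
  · intro z; rfl
  · intro x; rfl
  · intro x; rfl
  · rintro (e | e)
    · exact e.elim
    · rfl
  · intro e; rfl
  · rintro (e | e)
    · exact e.elim
    · rfl
  · rintro (e | e)
    · exact e.elim
    · rfl
  · rintro (e | e)
    · exact e.elim
    · rfl

/-- Postcomposing with a bijection, regarded as a circuit without edges, reindexes the outputs. -/
theorem comp_perm {m n : ℕ} {X : Type} [Finite X] (a : Fin m ≃ X) (b : Fin n ≃ X) {k : ℕ}
    (c : Circuit L (Fin k) (Fin m)) :
    (mk c).comp (mk (((Cospan.id X).reindex a b).toCircuit L)) =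
      mk (c.reindex (fun x => x) (fun y => a.symm (b y))) := by
  refine mk_eq ⟨⟨⟨⟨SetPushout.desc (fun z => z) (fun z => c.o (a.symm z.down)) ?_,
    fun z => SetPushout.proj _ _ (Sum.inl z), ?_, ?_⟩, ?_, ?_⟩,
    ⟨Sum.elim (fun e => e) (fun e => e.elim), Sum.inl, ?_, ?_⟩, ?_, ?_, ?_⟩⟩
  · intro y
    change c.o y = c.o (a.symm (a y))
    rw [Equiv.symm_apply_apply]
  · refine SetPushout.ind (fun z => rfl) (fun z => ?_)
    have := SetPushout.glue (i := (((Cospan.id.{u} X).reindex a b).toCircuit L).i) (o := c.o)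
      (a.symm z.down)
    refine Eq.trans this ?_
    congr 2
    change ULift.up (a (a.symm z.down)) = z
    rw [Equiv.apply_symm_apply]; rfl
  · intro z; rfl
  · intro x; rfl
  · intro x; rfl
  · rintro (e | e)
    · rfl
    · exact e.elim
  · intro e; rfl
  · rintro (e | e)
    · rfl
    · exact e.elim
  · rintro (e | e)
    · rfl
    · exact e.elim
  · rintro (e | e)
    · rfl
    · exact e.elim

theorem id_comp {m n : ℕ} (f : CircuitClass L m n) : (id L m).comp f = f := by
  obtain ⟨c, rfl⟩ := mk_surj f
  exact perm_comp (Equiv.refl _) (Equiv.refl _) c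

theorem comp_id {m n : ℕ} (f : CircuitClass L m n) : f.comp (id L n) = f := by
  obtain ⟨c, rfl⟩ := mk_surj f
  exact comp_perm (Equiv.refl _) (Equiv.refl _) c

theorem assoc {k l m n : ℕ} (f : CircuitClass L k l) (g : CircuitClass L l m)
    (h : CircuitClass L m n) : (f.comp g).comp h = f.comp (g.comp h) := by
  obtain ⟨f, rfl⟩ := mk_surj f
  obtain ⟨g, rfl⟩ := mk_surj g
  obtain ⟨h, rfl⟩ := mk_surj h
  refine mk_eq ⟨⟨⟨⟨SetPushout.desc (SetPushout.desc
        (fun a => SetPushout.proj _ _ (Sum.inl a))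
        (fun a => SetPushout.proj _ _ (Sum.inr (SetPushout.proj _ _ (Sum.inl a)))) ?_)
      (fun a => SetPushout.proj _ _ (Sum.inr (SetPushout.proj _ _ (Sum.inr a)))) ?_,
    SetPushout.desc (fun a => SetPushout.proj _ _ (Sum.inl (SetPushout.proj _ _ (Sum.inl a))))
      (SetPushout.desc
        (fun a => SetPushout.proj _ _ (Sum.inl (SetPushout.proj _ _ (Sum.inr a))))
        (fun a => SetPushout.proj _ _ (Sum.inr a)) ?_) ?_, ?_, ?_⟩, ?_, ?_⟩,
    Equiv.sumAssoc _ _ _, ?_, ?_, ?_⟩⟩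
  · intro y
    exact SetPushout.glue (o := f.o) (i := (g.comp h).i) y
  · intro y
    exact congrArg (fun z => SetPushout.proj f.o (g.comp h).i (Sum.inr z))
      (SetPushout.glue (o := g.o) (i := h.i) y)
  · intro y
    exact SetPushout.glue (o := (f.comp g).o) (i := h.i) y
  · intro y
    exact congrArg (fun z => SetPushout.proj (f.comp g).o h.i (Sum.inl z))
      (SetPushout.glue (o := f.o) (i := g.i) y)
  · exact SetPushout.ind (SetPushout.ind (fun _ => rfl) (fun _ => rfl)) (fun _ => rfl)
  · exact SetPushout.ind (fun _ => rfl) (SetPushout.ind (fun _ => rfl) (fun _ => rfl))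
  · intro x; rfl
  · intro x; rfl
  · rintro ((e | e) | e) <;> rfl
  · rintro ((e | e) | e) <;> rfl
  · rintro ((e | e) | e) <;> rfl

theorem tensor_id (m n : ℕ) : (id L m).tensor (id L n) = id L (m + n) := by
  refine mk_eq ⟨⟨⟨⟨fun z => ULift.up (finSumFinEquiv (Sum.map ULift.down ULift.down z)),
    fun z => Sum.map ULift.up ULift.up (finSumFinEquiv.symm z.down), ?_, ?_⟩, ?_, ?_⟩,
    ⟨Sum.elim (fun e => e.elim) (fun e => e.elim), fun e => e.elim, ?_, ?_⟩, ?_, ?_, ?_⟩⟩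
  · intro z
    change Sum.map _ _ (finSumFinEquiv.symm (finSumFinEquiv _)) = z
    rw [Equiv.symm_apply_apply]
    rcases z with z | z <;> rfl
  · rintro ⟨z⟩
    obtain ⟨z, rfl⟩ := finSumFinEquiv.surjective z
    change ULift.up (finSumFinEquiv (Sum.map _ _ (Sum.map _ _
      (finSumFinEquiv.symm (finSumFinEquiv z))))) = _
    rw [Equiv.symm_apply_apply]
    rcases z with z | z <;> rfl
  · intro x
    obtain ⟨x, rfl⟩ := finSumFinEquiv.surjective x
    change ULift.up (finSumFinEquiv (Sum.map _ _ (Sum.map _ _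
      (finSumFinEquiv.symm (finSumFinEquiv x))))) = ULift.up _
    rw [Equiv.symm_apply_apply]
    rcases x with x | x <;> rfl
  · intro x
    obtain ⟨x, rfl⟩ := finSumFinEquiv.surjective x
    change ULift.up (finSumFinEquiv (Sum.map _ _ (Sum.map _ _
      (finSumFinEquiv.symm (finSumFinEquiv x))))) = ULift.up _
    rw [Equiv.symm_apply_apply]
    rcases x with x | x <;> rfl
  · rintro (e | e) <;> exact e.elim
  · rintro e; exact e.elim
  · rintro (e | e) <;> exact e.elim
  · rintro (e | e) <;> exact e.elim
  · rintro (e | e) <;> exact e.elim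

theorem tensor_comp {l m n l' m' n' : ℕ} (f : CircuitClass L l m) (g : CircuitClass L m n)
    (f' : CircuitClass L l' m') (g' : CircuitClass L m' n') :
    (f.comp g).tensor (f'.comp g') = (f.tensor f').comp (g.tensor g') := by
  obtain ⟨f, rfl⟩ := mk_surj f
  obtain ⟨g, rfl⟩ := mk_surj g
  obtain ⟨f', rfl⟩ := mk_surj f'
  obtain ⟨g', rfl⟩ := mk_surj g'
  refine mk_eq ⟨⟨⟨⟨Sum.elim
      (SetPushout.desc (fun a => SetPushout.proj _ _ (Sum.inl (Sum.inl a)))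
        (fun a => SetPushout.proj _ _ (Sum.inr (Sum.inl a))) ?_)
      (SetPushout.desc (fun a => SetPushout.proj _ _ (Sum.inl (Sum.inr a)))
        (fun a => SetPushout.proj _ _ (Sum.inr (Sum.inr a))) ?_),
    SetPushout.desc (Sum.map (fun a => SetPushout.proj _ _ (Sum.inl a))
        (fun a => SetPushout.proj _ _ (Sum.inl a)))
      (Sum.map (fun a => SetPushout.proj _ _ (Sum.inr a))
        (fun a => SetPushout.proj _ _ (Sum.inr a))) ?_, ?_, ?_⟩, ?_, ?_⟩,
    Equiv.sumSumSumComm _ _ _ _, ?_, ?_, ?_⟩⟩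
  · intro y
    have := SetPushout.glue
      (o := ((f.tensor f').reindex finSumFinEquiv.symm (finSumFinEquiv (m := m) (n := m')).symm).o)
      (i := ((g.tensor g').reindex finSumFinEquiv.symm finSumFinEquiv.symm).i)
      (finSumFinEquiv (Sum.inl y))
    change SetPushout.proj _ _ (Sum.inl (Sum.map _ _ (finSumFinEquiv.symm _))) =
      SetPushout.proj _ _ (Sum.inr (Sum.map _ _ (finSumFinEquiv.symm _))) at this
    rw [Equiv.symm_apply_apply] at this
    exact this
  · intro y
    have := SetPushout.glue
      (o := ((f.tensor f').reindex finSumFinEquiv.symm (finSumFinEquiv (m := m) (n := m')).symm).o)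
      (i := ((g.tensor g').reindex finSumFinEquiv.symm finSumFinEquiv.symm).i)
      (finSumFinEquiv (Sum.inr y))
    change SetPushout.proj _ _ (Sum.inl (Sum.map _ _ (finSumFinEquiv.symm _))) =
      SetPushout.proj _ _ (Sum.inr (Sum.map _ _ (finSumFinEquiv.symm _))) at this
    rw [Equiv.symm_apply_apply] at this
    exact this
  · intro y
    obtain ⟨y, rfl⟩ := finSumFinEquiv.surjective y
    change Sum.map _ _ (Sum.map f.o f'.o (finSumFinEquiv.symm (finSumFinEquiv y))) =
      Sum.map _ _ (Sum.map g.i g'.i (finSumFinEquiv.symm (finSumFinEquiv y)))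
    rw [Equiv.symm_apply_apply]
    rcases y with y | y
    · exact congrArg Sum.inl (SetPushout.glue (o := f.o) (i := g.i) y)
    · exact congrArg Sum.inr (SetPushout.glue (o := f'.o) (i := g'.i) y)
  · rintro (z | z)
    · revert z; exact SetPushout.ind (fun _ => rfl) (fun _ => rfl)
    · revert z; exact SetPushout.ind (fun _ => rfl) (fun _ => rfl)
  · exact SetPushout.ind (by rintro (z | z) <;> rfl) (by rintro (z | z) <;> rfl)
  · intro x
    change Sum.elim _ _ (Sum.map _ _ (finSumFinEquiv.symm x)) =
      SetPushout.proj _ _ (Sum.inl (Sum.map _ _ (finSumFinEquiv.symm x)))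
    rcases finSumFinEquiv.symm x with x | x <;> rfl
  · intro x
    change Sum.elim _ _ (Sum.map _ _ (finSumFinEquiv.symm x)) =
      SetPushout.proj _ _ (Sum.inr (Sum.map _ _ (finSumFinEquiv.symm x)))
    rcases finSumFinEquiv.symm x with x | x <;> rfl
  · rintro ((e | e) | (e | e)) <;> rfl
  · rintro ((e | e) | (e | e)) <;> rfl
  · rintro ((e | e) | (e | e)) <;> rfl

theorem symm_cast_assoc {a b c : ℕ} (h : a + (b + c) = a + b + c) (x : Fin (a + (b + c))) :
    Equiv.sumAssoc _ _ _ (Sum.map (finSumFinEquiv.symm : Fin (a + b) → _) (fun z : Fin c => z)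
      (finSumFinEquiv.symm (Fin.cast h x))) =
    Sum.map (fun z => z) (finSumFinEquiv.symm : Fin (b + c) → _) (finSumFinEquiv.symm x) := by
  obtain ⟨x, rfl⟩ := finSumFinEquiv.surjective x
  rcases x with x | x
  · have : Fin.cast h (finSumFinEquiv (Sum.inl x)) =
        finSumFinEquiv (Sum.inl (finSumFinEquiv (Sum.inl x))) := by
      ext; simp
    rw [this]; simp
  · obtain ⟨x, rfl⟩ := finSumFinEquiv.surjective x
    rcases x with x | x
    · have : Fin.cast h (finSumFinEquiv (Sum.inr (finSumFinEquiv (Sum.inl x)))) =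
          finSumFinEquiv (Sum.inl (finSumFinEquiv (Sum.inr x))) := by
        ext; simp
      rw [this]; simp
    · have : Fin.cast h (finSumFinEquiv (Sum.inr (finSumFinEquiv (Sum.inr x)))) =
          finSumFinEquiv (Sum.inr x) := by
        ext; simp [Nat.add_assoc]
      rw [this]; simp

theorem tensor_assoc {m n m' n' m'' n'' : ℕ} (f : CircuitClass L m n) (g : CircuitClass L m' n')
    (h : CircuitClass L m'' n'') :
    castHom (Nat.add_assoc _ _ _) (Nat.add_assoc _ _ _) ((f.tensor g).tensor h) =
      f.tensor (g.tensor h) := by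
  obtain ⟨f, rfl⟩ := mk_surj f
  obtain ⟨g, rfl⟩ := mk_surj g
  obtain ⟨h, rfl⟩ := mk_surj h
  simp only [tensor_mk, castHom_mk]
  refine mk_eq ⟨⟨⟨Equiv.sumAssoc _ _ _, ?_, ?_⟩, Equiv.sumAssoc _ _ _, ?_, ?_, ?_⟩⟩
  · intro x
    have key := symm_cast_assoc (Nat.add_assoc m m' m'').symm x
    change Equiv.sumAssoc _ _ _ (Sum.map (fun z => Sum.map f.i g.i (finSumFinEquiv.symm z)) h.i
      (finSumFinEquiv.symm (Fin.cast _ x))) =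
      Sum.map f.i (fun z => Sum.map g.i h.i (finSumFinEquiv.symm z)) (finSumFinEquiv.symm x)
    have e := congrArg (Sum.map f.i (Sum.map g.i h.i)) key
    rw [Sum.map_map] at e
    refine Eq.trans ?_ e
    rcases finSumFinEquiv.symm (Fin.cast (Nat.add_assoc m m' m'').symm x) with y | y
    · simp only [Sum.map_inl]
      rcases finSumFinEquiv.symm y with y | y <;> rfl
    · rfl
  · intro x
    have key := symm_cast_assoc (Nat.add_assoc n n' n'').symm x
    change Equiv.sumAssoc _ _ _ (Sum.map (fun z => Sum.map f.o g.o (finSumFinEquiv.symm z)) h.o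
      (finSumFinEquiv.symm (Fin.cast _ x))) =
      Sum.map f.o (fun z => Sum.map g.o h.o (finSumFinEquiv.symm z)) (finSumFinEquiv.symm x)
    have e := congrArg (Sum.map f.o (Sum.map g.o h.o)) key
    rw [Sum.map_map] at e
    refine Eq.trans ?_ e
    rcases finSumFinEquiv.symm (Fin.cast (Nat.add_assoc n n' n'').symm x) with y | y
    · simp only [Sum.map_inl]
      rcases finSumFinEquiv.symm y with y | y <;> rfl
    · rfl
  · rintro ((e | e) | e) <;> rfl
  · rintro ((e | e) | e) <;> rfl
  · rintro ((e | e) | e) <;> rfl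

theorem symm_cast_zero_add {m : ℕ} (h : m = 0 + m) (x : Fin m) :
    finSumFinEquiv.symm (Fin.cast h x) = Sum.inr x := by
  rw [Equiv.symm_apply_eq]; ext; simp

theorem symm_cast_add_zero {m : ℕ} (h : m = m + 0) (x : Fin m) :
    finSumFinEquiv.symm (Fin.cast h x) = Sum.inl x := by
  rw [Equiv.symm_apply_eq]; rfl

theorem id_zero_tensor {m n : ℕ} (f : CircuitClass L m n) :
    castHom (Nat.zero_add _) (Nat.zero_add _) ((id L 0).tensor f) = f := by
  obtain ⟨f, rfl⟩ := mk_surj f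
  unfold id
  simp only [tensor_mk, castHom_mk]
  refine mk_eq ⟨⟨⟨⟨Sum.elim (fun z => z.down.elim0) (fun z => z), Sum.inr, ?_, ?_⟩, ?_, ?_⟩,
    ⟨Sum.elim (fun e => e.elim) (fun e => e), Sum.inr, ?_, ?_⟩, ?_, ?_, ?_⟩⟩
  · rintro (z | z)
    · exact z.down.elim0
    · rfl
  · intro z; rfl
  · intro x
    change Sum.elim _ _ (Sum.map _ _ (finSumFinEquiv.symm (Fin.cast _ x))) = _
    rw [symm_cast_zero_add]; rfl
  · intro x
    change Sum.elim _ _ (Sum.map _ _ (finSumFinEquiv.symm (Fin.cast _ x))) = _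
    rw [symm_cast_zero_add]; rfl
  · rintro (e | e)
    · exact e.elim
    · rfl
  · intro e; rfl
  · rintro (e | e)
    · exact e.elim
    · rfl
  · rintro (e | e)
    · exact e.elim
    · rfl
  · rintro (e | e)
    · exact e.elim
    · rfl

theorem tensor_id_zero {m n : ℕ} (f : CircuitClass L m n) :
    castHom (Nat.add_zero _) (Nat.add_zero _) (f.tensor (id L 0)) = f := by
  obtain ⟨f, rfl⟩ := mk_surj f
  unfold id
  simp only [tensor_mk, castHom_mk]
  refine mk_eq ⟨⟨⟨⟨Sum.elim (fun z => z) (fun z => z.down.elim0), Sum.inl, ?_, ?_⟩, ?_, ?_⟩,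
    ⟨Sum.elim (fun e => e) (fun e => e.elim), Sum.inl, ?_, ?_⟩, ?_, ?_, ?_⟩⟩
  · rintro (z | z)
    · rfl
    · exact z.down.elim0
  · intro z; rfl
  · intro x
    change Sum.elim _ _ (Sum.map _ _ (finSumFinEquiv.symm (Fin.cast _ x))) = _
    rw [symm_cast_add_zero]; rfl
  · intro x
    change Sum.elim _ _ (Sum.map _ _ (finSumFinEquiv.symm (Fin.cast _ x))) = _
    rw [symm_cast_add_zero]; rfl
  · rintro (e | e)
    · rfl
    · exact e.elim
  · intro e; rfl
  · rintro (e | e)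
    · rfl
    · exact e.elim
  · rintro (e | e)
    · rfl
    · exact e.elim
  · rintro (e | e)
    · rfl
    · exact e.elim

/-- The braiding as the cospan of a bijection. -/
theorem braid_eq (m n : ℕ) :
    braid L m n = mk (((Cospan.id (Fin m ⊕ Fin n)).reindex finSumFinEquiv.symm
      (finSumFinEquiv.symm.trans (Equiv.sumComm (Fin n) (Fin m)))).toCircuit L) := rfl

theorem braid_naturality {m n m' n' : ℕ} (f : CircuitClass L m n) (g : CircuitClass L m' n') :
    (f.tensor g).comp (braid L n n') = (braid L m m').comp (g.tensor f) := by
  obtain ⟨f, rfl⟩ := mk_surj f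
  obtain ⟨g, rfl⟩ := mk_surj g
  rw [tensor_mk, tensor_mk, braid_eq, braid_eq, comp_perm, perm_comp]
  refine mk_eq ⟨⟨⟨Equiv.sumComm _ _, ?_, ?_⟩, Equiv.sumComm _ _, ?_, ?_, ?_⟩⟩
  · intro x
    obtain ⟨x, rfl⟩ := finSumFinEquiv.surjective x
    rcases x with x | x <;>
      simp [Circuit.reindex, Circuit.tensor, Cospan.reindex, Cospan.tensor] <;> rfl
  · intro x
    obtain ⟨x, rfl⟩ := finSumFinEquiv.surjective x
    rcases x with x | x <;>
      simp [Circuit.reindex, Circuit.tensor, Cospan.reindex, Cospan.tensor] <;> rfl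
  · rintro (e | e) <;> rfl
  · rintro (e | e) <;> rfl
  · rintro (e | e) <;> rfl

/-- Two bijections give the same circuit if they agree. -/
theorem perm_ext {m n : ℕ} {X Y : Type} [Finite X] [Finite Y] (a : Fin m ≃ X) (b : Fin n ≃ X)
    (a' : Fin m ≃ Y) (b' : Fin n ≃ Y) (h : ∀ y, a'.symm (b' y) = a.symm (b y)) :
    mk (((Cospan.id X).reindex a b).toCircuit L) =
      mk (((Cospan.id Y).reindex a' b').toCircuit L) := by
  refine mk_eq (Cospan.toCircuit_congr L ⟨⟨⟨fun z => ULift.up (a' (a.symm z.down)),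
    fun z => ULift.up (a (a'.symm z.down)), ?_, ?_⟩, ?_, ?_⟩⟩)
  · intro z; simp; rfl
  · intro z; simp; rfl
  · intro x
    change ULift.up (a' (a.symm (a x))) = ULift.up (a' x)
    rw [Equiv.symm_apply_apply]
  · intro y
    change ULift.up (a' (a.symm (b y))) = ULift.up (b' y)
    rw [← h, Equiv.apply_symm_apply]

theorem braid_symm (m n : ℕ) : (braid L m n).comp (braid L n m) = id L (m + n) := by
  rw [braid_eq m n, braid_eq n m, perm_comp]
  refine perm_ext (Equiv.trans _ (Equiv.trans (Equiv.symm _) finSumFinEquiv.symm)) _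
    (Equiv.refl _) (Equiv.refl _) ?_
  intro y
  simp

theorem braid_zero (n : ℕ) :
    castHom (Nat.zero_add _) (Nat.add_zero _) (braid L 0 n) = id L n := by
  rw [braid_eq, castHom_mk]
  refine perm_ext ((finCongr (Nat.zero_add n).symm).trans finSumFinEquiv.symm)
    ((finCongr (Nat.add_zero n).symm).trans (finSumFinEquiv.symm.trans (Equiv.sumComm _ _)))
    (Equiv.refl _) (Equiv.refl _) ?_
  intro y
  symm
  rw [Equiv.symm_apply_eq]
  change Equiv.sumComm _ _ (finSumFinEquiv.symm (Fin.cast (Nat.add_zero n).symm y)) =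
    finSumFinEquiv.symm (Fin.cast (Nat.zero_add n).symm y)
  rw [symm_cast_zero_add, symm_cast_add_zero]; rfl

/-- The tensor product of two bijections. -/
theorem perm_tensor {m n m' n' : ℕ} {X X' : Type} [Finite X] [Finite X'] (a : Fin m ≃ X)
    (b : Fin n ≃ X) (a' : Fin m' ≃ X') (b' : Fin n' ≃ X') :
    (mk (((Cospan.id X).reindex a b).toCircuit L)).tensor
        (mk (((Cospan.id X').reindex a' b').toCircuit L)) =
      mk (((Cospan.id (X ⊕ X')).reindex (finSumFinEquiv.symm.trans (Equiv.sumCongr a a'))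
        (finSumFinEquiv.symm.trans (Equiv.sumCongr b b'))).toCircuit L) := by
  refine mk_eq ⟨⟨⟨⟨Sum.elim (fun z => ULift.up (Sum.inl z.down)) (fun z => ULift.up (Sum.inr z.down)),
    fun z => Sum.map ULift.up ULift.up z.down, ?_, ?_⟩, ?_, ?_⟩,
    ⟨Sum.elim (fun e => e.elim) (fun e => e.elim), fun e => e.elim, ?_, ?_⟩, ?_, ?_, ?_⟩⟩
  · rintro (z | z) <;> rfl
  · rintro ⟨z | z⟩ <;> rfl
  · intro x
    change Sum.elim _ _ (Sum.map _ _ (finSumFinEquiv.symm x)) =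
      ULift.up (Equiv.sumCongr a a' (finSumFinEquiv.symm x))
    rcases finSumFinEquiv.symm x with x | x <;> rfl
  · intro x
    change Sum.elim _ _ (Sum.map _ _ (finSumFinEquiv.symm x)) =
      ULift.up (Equiv.sumCongr b b' (finSumFinEquiv.symm x))
    rcases finSumFinEquiv.symm x with x | x <;> rfl
  · rintro (e | e) <;> exact e.elim
  · rintro e; exact e.elim
  · rintro (e | e) <;> exact e.elim
  · rintro (e | e) <;> exact e.elim
  · rintro (e | e) <;> exact e.elim

theorem perm_cast {m n m' n' : ℕ} {X : Type} [Finite X] (a : Fin m ≃ X) (b : Fin n ≃ X)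
    (hm : m = m') (hn : n = n') :
    castHom (H := CircuitClass L) hm hn (mk (((Cospan.id X).reindex a b).toCircuit L)) =
      mk (((Cospan.id X).reindex ((finCongr hm.symm).trans a)
        ((finCongr hn.symm).trans b)).toCircuit L) := by
  subst hm hn; rfl

theorem perm_comp_perm {k m n : ℕ} {X Y : Type} [Finite X] [Finite Y] (a : Fin k ≃ X)
    (b : Fin m ≃ X) (a' : Fin m ≃ Y) (b' : Fin n ≃ Y) :
    (mk (((Cospan.id X).reindex a b).toCircuit L)).comp
        (mk (((Cospan.id Y).reindex a' b').toCircuit L)) =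
      mk (((Cospan.id Y).reindex ((a.trans b.symm).trans a') b').toCircuit L) :=
  perm_comp a b _

theorem id_eq (m : ℕ) : id L m =
    mk (((Cospan.id (Fin m)).reindex (Equiv.refl _) (Equiv.refl _)).toCircuit L) := rfl

theorem cast_assoc_inl {a b c : ℕ} (h : a + b + c = a + (b + c)) (x : Fin a) :
    Fin.cast h (finSumFinEquiv (Sum.inl (finSumFinEquiv (Sum.inl x)))) =
      finSumFinEquiv (Sum.inl x) := by
  ext; simp

theorem cast_assoc_mid {a b c : ℕ} (h : a + b + c = a + (b + c)) (x : Fin b) :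
    Fin.cast h (finSumFinEquiv (Sum.inl (finSumFinEquiv (Sum.inr x)))) =
      finSumFinEquiv (Sum.inr (finSumFinEquiv (Sum.inl x))) := by
  ext; simp

theorem cast_assoc_inr {a b c : ℕ} (h : a + b + c = a + (b + c)) (x : Fin c) :
    Fin.cast h (finSumFinEquiv (Sum.inr x)) =
      finSumFinEquiv (Sum.inr (finSumFinEquiv (Sum.inr x))) := by
  ext; simp [Nat.add_assoc]

theorem cast_assoc_inl' {a b c : ℕ} (h : a + (b + c) = a + b + c) (x : Fin a) :
    Fin.cast h (finSumFinEquiv (Sum.inl x)) =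
      finSumFinEquiv (Sum.inl (finSumFinEquiv (Sum.inl x))) := by
  ext; simp

theorem cast_assoc_mid' {a b c : ℕ} (h : a + (b + c) = a + b + c) (x : Fin b) :
    Fin.cast h (finSumFinEquiv (Sum.inr (finSumFinEquiv (Sum.inl x)))) =
      finSumFinEquiv (Sum.inl (finSumFinEquiv (Sum.inr x))) := by
  ext; simp

theorem cast_assoc_inr' {a b c : ℕ} (h : a + (b + c) = a + b + c) (x : Fin c) :
    Fin.cast h (finSumFinEquiv (Sum.inr (finSumFinEquiv (Sum.inr x)))) =
      finSumFinEquiv (Sum.inr x) := by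
  ext; simp [Nat.add_assoc]

theorem hexagon (l m n : ℕ) :
    castHom (Nat.add_assoc l m n) (Nat.add_assoc m n l).symm
      (((braid L l m).tensor (id L n)).comp
        (castHom (Nat.add_assoc m l n).symm rfl ((id L m).tensor (braid L l n)))) =
      braid L l (m + n) := by
  simp only [braid_eq, id_eq, perm_tensor, perm_cast, perm_comp_perm]
  apply perm_ext
  intro y
  symm
  rw [Equiv.symm_apply_eq]
  obtain ⟨y, rfl⟩ := finSumFinEquiv.surjective y
  rcases y with y | y
  on_goal 1 =>
    obtain ⟨y, rfl⟩ := finSumFinEquiv.surjective y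
    rcases y with y | y
  all_goals
    simp [-finSumFinEquiv_apply_left, -finSumFinEquiv_apply_right, cast_assoc_inl, cast_assoc_mid,
      cast_assoc_inr, cast_assoc_inl', cast_assoc_mid', cast_assoc_inr']

end CircuitClass

/-- The prop of `L`-circuits. -/
def Circ (L : Type u) : PropCat.{u + 1} where
  hom := CircuitClass L
  id := CircuitClass.id L
  comp := CircuitClass.comp
  tensor := CircuitClass.tensor
  braid := CircuitClass.braid L
  id_comp := CircuitClass.id_comp
  comp_id := CircuitClass.comp_id
  assoc := CircuitClass.assoc
  tensor_id := CircuitClass.tensor_id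
  tensor_comp := CircuitClass.tensor_comp
  tensor_assoc := CircuitClass.tensor_assoc
  id_zero_tensor := CircuitClass.id_zero_tensor
  tensor_id_zero := CircuitClass.tensor_id_zero
  braid_naturality := CircuitClass.braid_naturality
  braid_symm := CircuitClass.braid_symm
  braid_zero := CircuitClass.braid_zero
  hexagon := CircuitClass.hexagon

/-- Isomorphism classes of cospans of finite sets from an `m`-element set to an `n`-element
set. -/
def CospanClass (m n : ℕ) : Type (u + 1) := Quotient (cospanSetoid.{u} (Fin m) (Fin n))

namespace CospanClass

/-- The isomorphism class of a cospan. -/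
def mk {m n : ℕ} (c : Cospan.{u} (Fin m) (Fin n)) : CospanClass.{u} m n :=
  Quotient.mk (cospanSetoid (Fin m) (Fin n)) c

theorem mk_surj {m n : ℕ} (c : CospanClass.{u} m n) : ∃ d, mk d = c :=
  Quotient.exists_rep c

/-- The identity morphism. -/
def id (m : ℕ) : CospanClass.{u} m m := mk (Cospan.id (Fin m))

/-- Composition of classes. -/
def comp {l m n : ℕ} (f : CospanClass.{u} l m) (g : CospanClass.{u} m n) : CospanClass.{u} l n :=
  Quotient.map₂ Cospan.comp (fun _ _ h _ _ h' => Cospan.comp_congr h h') f g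

/-- Tensor product of classes, identifying the set `m + m'` with the disjoint union of `m` and
`m'`. -/
def tensor {m n m' n' : ℕ} (f : CospanClass.{u} m n) (g : CospanClass.{u} m' n') :
    CospanClass.{u} (m + m') (n + n') :=
  Quotient.map₂
    (fun c d => (Cospan.tensor c d).reindex finSumFinEquiv.symm finSumFinEquiv.symm)
    (fun _ _ h _ _ h' => Cospan.reindex_congr _ _ (Cospan.tensor_congr h h')) f g

/-- The braiding. -/
def braid (m n : ℕ) : CospanClass.{u} (m + n) (n + m) :=
  mk ((Cospan.braid (Fin m) (Fin n)).reindex finSumFinEquiv.symm finSumFinEquiv.symm)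

/-- The class of a cospan regarded as a circuit with no edges. -/
def toCircuit (L : Type u) {m n : ℕ} (f : CospanClass.{u} m n) : CircuitClass L m n :=
  Quotient.map (Cospan.toCircuit L) (fun _ _ h => Cospan.toCircuit_congr L h) f

theorem toCircuit_injective (L : Type u) {m n : ℕ} {f g : CospanClass.{u} m n}
    (h : f.toCircuit L = g.toCircuit L) : f = g := by
  obtain ⟨c, rfl⟩ := mk_surj f
  obtain ⟨d, rfl⟩ := mk_surj g
  obtain ⟨k⟩ := CircuitClass.mk_exact h
  exact Quotient.sound ⟨k.toIso⟩

theorem toCircuit_id (L : Type u) (m : ℕ) : (id m).toCircuit L = CircuitClass.id L m := rfl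

theorem toCircuit_braid (L : Type u) (m n : ℕ) :
    (braid m n).toCircuit L = CircuitClass.braid L m n := rfl

theorem toCircuit_comp (L : Type u) {l m n : ℕ} (f : CospanClass.{u} l m)
    (g : CospanClass.{u} m n) :
    (f.comp g).toCircuit L = (f.toCircuit L).comp (g.toCircuit L) := by
  obtain ⟨c, rfl⟩ := mk_surj f
  obtain ⟨d, rfl⟩ := mk_surj g
  exact CircuitClass.mk_eq (Cospan.toCircuit_comp L c d)

theorem toCircuit_tensor (L : Type u) {m n m' n' : ℕ} (f : CospanClass.{u} m n)
    (g : CospanClass.{u} m' n') :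
    (f.tensor g).toCircuit L = (f.toCircuit L).tensor (g.toCircuit L) := by
  obtain ⟨c, rfl⟩ := mk_surj f
  obtain ⟨d, rfl⟩ := mk_surj g
  exact CircuitClass.mk_eq (Circuit.reindex_congr _ _ (Cospan.toCircuit_tensor L c d))

theorem toCircuit_castHom (L : Type u) {m m' n n' : ℕ} (hm : m = m') (hn : n = n')
    (f : CospanClass.{u} m n) :
    toCircuit L (castHom (H := CospanClass.{u}) hm hn f) =
      castHom (H := CircuitClass L) hm hn (f.toCircuit L) := by
  subst hm hn; rfl

end CospanClass

open CospanClass in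
/-- The prop of cospans of finite sets. -/
def FinCospan : PropCat.{u + 1} where
  hom := CospanClass.{u}
  id := CospanClass.id
  comp := CospanClass.comp
  tensor := CospanClass.tensor
  braid := CospanClass.braid
  id_comp f := toCircuit_injective PEmpty <| by
    simp only [toCircuit_comp, toCircuit_id, CircuitClass.id_comp]
  comp_id f := toCircuit_injective PEmpty <| by
    simp only [toCircuit_comp, toCircuit_id, CircuitClass.comp_id]
  assoc f g h := toCircuit_injective PEmpty <| by
    simp only [toCircuit_comp, CircuitClass.assoc]
  tensor_id m n := toCircuit_injective PEmpty <| by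
    simp only [toCircuit_tensor, toCircuit_id, CircuitClass.tensor_id]
  tensor_comp f g f' g' := toCircuit_injective PEmpty <| by
    simp only [toCircuit_comp, toCircuit_tensor, CircuitClass.tensor_comp]
  tensor_assoc f g h := toCircuit_injective PEmpty <| by
    simp only [toCircuit_castHom, toCircuit_tensor, CircuitClass.tensor_assoc]
  id_zero_tensor f := toCircuit_injective PEmpty <| by
    simp only [toCircuit_castHom, toCircuit_tensor, toCircuit_id, CircuitClass.id_zero_tensor]
  tensor_id_zero f := toCircuit_injective PEmpty <| by
    simp only [toCircuit_castHom, toCircuit_tensor, toCircuit_id, CircuitClass.tensor_id_zero]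
  braid_naturality f g := toCircuit_injective PEmpty <| by
    simp only [toCircuit_comp, toCircuit_tensor, toCircuit_braid, CircuitClass.braid_naturality]
  braid_symm m n := toCircuit_injective PEmpty <| by
    simp only [toCircuit_comp, toCircuit_braid, toCircuit_id, CircuitClass.braid_symm]
  braid_zero n := toCircuit_injective PEmpty <| by
    simp only [toCircuit_castHom, toCircuit_braid, toCircuit_id, CircuitClass.braid_zero]
  hexagon l m n := toCircuit_injective PEmpty <| by
    simp only [toCircuit_castHom, toCircuit_comp, toCircuit_tensor, toCircuit_braid, toCircuit_id,
      CircuitClass.hexagon]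

/-! ## The two inclusions -/

/-- The morphism of props regarding a cospan as a circuit with no edges. -/
def cospanToCirc (L : Type u) : FinCospan.{u} ⟶ Circ L :=
  show PropCat.Hom FinCospan.{u} (Circ L) from
  { map := CospanClass.toCircuit L
    map_id := CospanClass.toCircuit_id L
    map_comp := CospanClass.toCircuit_comp L
    map_tensor := CospanClass.toCircuit_tensor L
    map_braid := CospanClass.toCircuit_braid L }

/-- The morphism of props sending the generator `ℓ` to the circuit with a single edge labelled
`ℓ`, from the input to the output. -/
def actionToCirc (L : Type u) : ActionProp L ⟶ Circ L :=
  FreeProp.lift (P := Circ L) (fun _ _ x =>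
    match x with
    | .op ℓ => CircuitClass.mk (Circuit.edge ℓ))

/-!
Bending the input of an edge around along the cospan `cup : 0 → 1 ← 2` turns it into a state
`0 ⟶ 2`, and the snake identity recovers the edge from this state. Every circuit is therefore
obtained by first creating the states of its edges, next to the inputs, and then connecting all
wires by a single cospan. Peeling off the states one at a time shows that a morphism out of
`Circ L` is determined by its restrictions to `FinCospan` and `ActionProp L`.

Conversely, given `G : FinCospan ⟶ P` and `A : ActionProp L ⟶ P`, the same recipe carried out in `P`
evaluates a circuit. The order of the edges does not matter because a cospan absorbs the braiding
of two states. Evaluation preserves composition because a cospan followed by the creation of a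
state is that creation followed by a cospan enlarged by the new wires, and the pushout against the
enlarged cospan is still the pushout of the two node sets.
-/

theorem castHom_symm_castHom {H : ℕ → ℕ → Type v} {m m' n n' : ℕ} (hm : m = m') (hn : n = n')
    (f : H m n) : castHom hm.symm hn.symm (castHom hm hn f) = f := by
  subst hm hn; rfl

namespace PropCat

variable {P : PropCat.{v}}

theorem castHom_comp (P : PropCat.{v}) {l l' m m' n n' : ℕ} (hl : l = l') (hm : m = m')
    (hn : n = n') (f : P.hom l m) (g : P.hom m n) :
    castHom hl hn (P.comp f g) = P.comp (castHom hl hm f) (castHom hm hn g) := by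
  subst hl hm hn; rfl

theorem comp_castHom_symm (P : PropCat.{v}) {l m m' n : ℕ} (hm : m = m') (f : P.hom l m)
    (g : P.hom m' n) : P.comp f (castHom hm.symm rfl g) = P.comp (castHom rfl hm f) g := by
  subst hm; rfl

theorem tensor_eq_whiskerRight_comp_whiskerLeft (P : PropCat.{v}) {m n m' n' : ℕ} (f : P.hom m n)
    (g : P.hom m' n') :
    P.tensor f g = P.comp (P.tensor f (P.id m')) (P.tensor (P.id n) g) := by
  rw [← P.tensor_comp, P.comp_id, P.id_comp]

theorem tensor_eq_whiskerLeft_comp_whiskerRight (P : PropCat.{v}) {m n m' n' : ℕ} (f : P.hom m n)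
    (g : P.hom m' n') :
    P.tensor f g = P.comp (P.tensor (P.id m) g) (P.tensor f (P.id n')) := by
  rw [← P.tensor_comp, P.comp_id, P.id_comp]

theorem whiskerRight_eq_braid_comp_whiskerLeft_comp_braid (P : PropCat.{v}) {m n : ℕ}
    (f : P.hom m n) (r : ℕ) :
    P.tensor f (P.id r) =
      P.comp (P.braid m r) (P.comp (P.tensor (P.id r) f) (P.braid r n)) := by
  rw [P.braid_naturality, ← P.assoc, P.braid_symm, P.id_comp]

theorem whiskerLeft_comp (P : PropCat.{v}) (r : ℕ) {l m n : ℕ} (f : P.hom l m) (g : P.hom m n) :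
    P.tensor (P.id r) (P.comp f g) = P.comp (P.tensor (P.id r) f) (P.tensor (P.id r) g) := by
  rw [← P.tensor_comp, P.id_comp]

theorem map_tensor_of_whiskerLeft {P Q : PropCat.{v}} (φ : ∀ {m n}, P.hom m n → Q.hom m n)
    (map_comp : ∀ {l m n} (f : P.hom l m) (g : P.hom m n), φ (P.comp f g) = Q.comp (φ f) (φ g))
    (map_braid : ∀ m n, φ (P.braid m n) = Q.braid m n)
    (map_whiskerLeft : ∀ (r : ℕ) {m n} (f : P.hom m n),
      φ (P.tensor (P.id r) f) = Q.tensor (Q.id r) (φ f))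
    {m n m' n' : ℕ} (f : P.hom m n) (g : P.hom m' n') :
    φ (P.tensor f g) = Q.tensor (φ f) (φ g) := by
  rw [P.tensor_eq_whiskerRight_comp_whiskerLeft, Q.tensor_eq_whiskerRight_comp_whiskerLeft,
    P.whiskerRight_eq_braid_comp_whiskerLeft_comp_braid,
    Q.whiskerRight_eq_braid_comp_whiskerLeft_comp_braid]
  simp only [map_comp, map_braid, map_whiskerLeft]

/-- The morphism creating `p` new wires in the state `σ` to the right of `m` given ones, that is
`id m ⊗ σ`. The type uses that `m + 0` reduces to `m`. -/
def appendState (m : ℕ) {p : ℕ} (σ : P.hom 0 p) : P.hom m (m + p) := P.tensor (P.id m) σ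

theorem comp_appendState {m n p : ℕ} (f : P.hom m n) (σ : P.hom 0 p) :
    P.comp f (appendState n σ) = P.comp (appendState m σ) (P.tensor f (P.id p)) :=
  calc P.comp f (appendState n σ)
    _ = P.comp (P.tensor f (P.id 0)) (P.tensor (P.id n) σ) :=
      congrArg (P.comp · (appendState n σ)) (P.tensor_id_zero f).symm
    _ = P.tensor f σ := (P.tensor_eq_whiskerRight_comp_whiskerLeft f σ).symm
    _ = P.comp (appendState m σ) (P.tensor f (P.id p)) :=
      P.tensor_eq_whiskerLeft_comp_whiskerRight f σ

theorem appendState_comp (m : ℕ) {p q : ℕ} (σ : P.hom 0 p) (f : P.hom p q) :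
    appendState m (P.comp σ f) = P.comp (appendState m σ) (P.tensor (P.id m) f) :=
  P.whiskerLeft_comp m σ f

theorem whiskerLeft_appendState (r m : ℕ) {p : ℕ} (σ : P.hom 0 p) :
    P.tensor (P.id r) (appendState m σ) =
      castHom rfl (Nat.add_assoc r m p) (appendState (r + m) σ) := by
  rw [appendState, appendState, ← P.tensor_id]
  exact (P.tensor_assoc (P.id r) (P.id m) σ).symm

theorem appendState_tensor (m : ℕ) {p q : ℕ} (σ : P.hom 0 p) (τ : P.hom 0 q) :
    appendState m (P.tensor σ τ) = castHom rfl (Nat.add_assoc m p q)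
      (P.comp (appendState m σ) (appendState (m + p) τ)) := by
  have tensor_eq : P.tensor σ τ = P.comp σ (appendState p τ) :=
    (P.tensor_eq_whiskerRight_comp_whiskerLeft σ τ).trans
      (congrArg (P.comp · (appendState p τ)) (P.tensor_id_zero σ))
  rw [P.castHom_comp rfl rfl, ← whiskerLeft_appendState]
  exact (congrArg (appendState m) tensor_eq).trans (appendState_comp m σ _)

theorem tensor_comp_braid_of_states {p q : ℕ} (σ : P.hom 0 p) (τ : P.hom 0 q) :
    P.comp (P.tensor σ τ) (P.braid p q) = P.tensor τ σ :=
  calc P.comp (P.tensor σ τ) (P.braid p q)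
    _ = P.comp (P.braid 0 0) (P.tensor τ σ) := P.braid_naturality σ τ
    _ = P.comp (P.id 0) (P.tensor τ σ) :=
      congrArg (P.comp · (P.tensor τ σ)) (P.braid_zero 0)
    _ = P.tensor τ σ := P.id_comp _

/-- The state obtained from `f` by bending its inputs around to outputs along `cup`. -/
def bend {p q n : ℕ} (cup : P.hom 0 (q + p)) (f : P.hom p n) : P.hom 0 (q + n) :=
  P.comp cup (P.tensor (P.id q) f)

theorem map_appendState {Q : PropCat.{v}} (F : PropCat.Hom P Q) (m : ℕ) {p : ℕ} (σ : P.hom 0 p) :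
    F.map (appendState m σ) = appendState m (F.map σ) :=
  (F.map_tensor (P.id m) σ).trans (congrArg (Q.tensor · (F.map σ)) (F.map_id m))

theorem map_bend {Q : PropCat.{v}} (F : PropCat.Hom P Q) {p q n : ℕ} (cup : P.hom 0 (q + p))
    (f : P.hom p n) : F.map (bend cup f) = bend (F.map cup) (F.map f) := by
  rw [bend, F.map_comp, F.map_tensor, F.map_id, bend]

theorem Hom.map_castHom {P Q : PropCat.{v}} (F : PropCat.Hom P Q) {m m' n n' : ℕ} (hm : m = m')
    (hn : n = n') (f : P.hom m n) : F.map (castHom hm hn f) = castHom hm hn (F.map f) := by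
  subst hm hn; rfl

/-- The snake identity for `cup` and `cap`: together they exhibit a duality between `p` and `q`. -/
def Snake {p q : ℕ} (cup : P.hom 0 (q + p)) (cap : P.hom (p + q) 0) : Prop :=
  P.comp (castHom rfl (Nat.add_assoc p q p).symm (appendState p cup)) (P.tensor cap (P.id p)) =
    castHom rfl (Nat.zero_add p).symm (P.id p)

theorem Snake.unbend {p q n : ℕ} {cup : P.hom 0 (q + p)} {cap : P.hom (p + q) 0}
    (h : Snake cup cap) (f : P.hom p n) :
    P.comp (castHom rfl (Nat.add_assoc p q n).symm (appendState p (bend cup f)))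
      (P.tensor cap (P.id n)) = castHom rfl (Nat.zero_add n).symm f := by
  have whisker_eq : P.tensor (P.id p) (P.tensor (P.id q) f) =
      castHom (Nat.add_assoc p q p) (Nat.add_assoc p q n) (P.tensor (P.id (p + q)) f) := by
    rw [← P.tensor_id, P.tensor_assoc]
  have zero_tensor : P.tensor (P.id 0) f =
      castHom (Nat.zero_add p).symm (Nat.zero_add n).symm f := by
    rw [← castHom_symm_castHom (Nat.zero_add p) (Nat.zero_add n) (P.tensor (P.id 0) f),
      P.id_zero_tensor]
  have append_eq : castHom rfl (Nat.add_assoc p q n).symm (appendState p (bend cup f)) =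
      P.comp (castHom rfl (Nat.add_assoc p q p).symm (appendState p cup))
        (P.tensor (P.id (p + q)) f) := by
    rw [bend, appendState_comp, P.castHom_comp rfl (Nat.add_assoc p q p).symm, whisker_eq,
      castHom_symm_castHom]
  rw [append_eq, P.assoc, ← P.tensor_eq_whiskerLeft_comp_whiskerRight,
    P.tensor_eq_whiskerRight_comp_whiskerLeft, ← P.assoc, h, zero_tensor,
    ← P.castHom_comp, P.id_comp]

theorem Snake.map {P Q : PropCat.{v}} {p q : ℕ} {cup : P.hom 0 (q + p)} {cap : P.hom (p + q) 0}
    (h : Snake cup cap) (F : PropCat.Hom P Q) : Snake (F.map cup) (F.map cap) := by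
  have := congrArg F.map h
  rwa [F.map_comp, F.map_tensor, F.map_castHom, F.map_castHom, map_appendState, F.map_id] at this

end PropCat

namespace FreeProp

theorem hom_ext {S : ℕ → ℕ → Type v} {P : PropCat.{v}} {F F' : PropCat.Hom (FreeProp S) P}
    (h : ∀ m n (x : S m n), F.map (mk (.gen x)) = F'.map (mk (.gen x))) : F = F' := by
  have map_mk_eq {m n : ℕ} (t : Term S m n) : F.map (mk t) = F'.map (mk t) := by
    induction t with
    | gen x => exact h _ _ x
    | id m => exact (F.map_id m).trans (F'.map_id m).symm
    | comp f g ihf ihg =>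
      exact (F.map_comp (mk f) (mk g)).trans
        ((congrArg₂ P.comp ihf ihg).trans (F'.map_comp (mk f) (mk g)).symm)
    | tensor f g ihf ihg =>
      exact (F.map_tensor (mk f) (mk g)).trans
        ((congrArg₂ P.tensor ihf ihg).trans (F'.map_tensor (mk f) (mk g)).symm)
    | braid m n => exact (F.map_braid m n).trans (F'.map_braid m n).symm
  ext m n f
  obtain ⟨t, rfl⟩ := mk_surj f
  exact map_mk_eq t

end FreeProp

/-- The square `j ∘ o = j' ∘ i` is a pushout of sets. The foot `Y` may live in a lower universe than
the apexes, as it does for cospans between the sets `Fin n`, so `CategoryTheory.IsPushout` does not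
apply. -/
structure IsSetPushout {Y : Type w} {N N' : Type u} {Z : Type v} (o : Y → N) (i : Y → N')
    (j : N → Z) (j' : N' → Z) : Prop where
  comm : ∀ y, j (o y) = j' (i y)
  bijective_desc : Function.Bijective (SetPushout.desc j j' comm)

namespace IsSetPushout

variable {Y : Type w} {N N' : Type u} {Z : Type v} {o : Y → N} {i : Y → N'} {j : N → Z}
  {j' : N' → Z}

theorem of_retract (comm : ∀ y, j (o y) = j' (i y))
    (surj : ∀ z, (∃ x, j x = z) ∨ ∃ x, j' x = z) (r : Z → SetPushout o i)
    (retract_left : ∀ x, r (j x) = SetPushout.proj o i (Sum.inl x))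
    (retract_right : ∀ x, r (j' x) = SetPushout.proj o i (Sum.inr x)) :
    IsSetPushout o i j j' where
  comm := comm
  bijective_desc := by
    refine ⟨Function.LeftInverse.injective (g := r)
      (SetPushout.ind retract_left retract_right), fun z => ?_⟩
    rcases surj z with ⟨x, rfl⟩ | ⟨x, rfl⟩
    · exact ⟨SetPushout.proj o i (Sum.inl x), rfl⟩
    · exact ⟨SetPushout.proj o i (Sum.inr x), rfl⟩

theorem setPushout (o : Y → N) (i : Y → N') :
    IsSetPushout o i (fun x => SetPushout.proj o i (Sum.inl x))
      (fun x => SetPushout.proj o i (Sum.inr x)) :=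
  of_retract SetPushout.glue (SetPushout.ind (fun x => Or.inl ⟨x, rfl⟩) fun x => Or.inr ⟨x, rfl⟩)
    (fun z => z) (fun _ => rfl) (fun _ => rfl)

theorem of_equiv (e : Y ≃ N) (i : Y → N') : IsSetPushout e i (i ∘ e.symm) id :=
  of_retract (fun y => congrArg i (e.symm_apply_apply y)) (fun z => Or.inr ⟨z, rfl⟩)
    (fun x => SetPushout.proj e i (Sum.inr x))
    (fun x => (SetPushout.glue (e.symm x)).symm.trans
      (congrArg (fun y => SetPushout.proj e i (Sum.inl y)) (e.apply_symm_apply x)))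
    (fun _ => rfl)

/-- The comparison of a pushout with the standard one. -/
noncomputable def equiv (h : IsSetPushout o i j j') : SetPushout o i ≃ Z :=
  Equiv.ofBijective _ h.bijective_desc

theorem equiv_symm_left (h : IsSetPushout o i j j') (x : N) :
    h.equiv.symm (j x) = SetPushout.proj o i (Sum.inl x) :=
  h.equiv.symm_apply_apply (SetPushout.proj o i (Sum.inl x))

theorem equiv_symm_right (h : IsSetPushout o i j j') (x : N') :
    h.equiv.symm (j' x) = SetPushout.proj o i (Sum.inr x) :=
  h.equiv.symm_apply_apply (SetPushout.proj o i (Sum.inr x))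

theorem jointly_surjective (h : IsSetPushout o i j j') (z : Z) :
    (∃ x, j x = z) ∨ ∃ x, j' x = z := by
  obtain ⟨p, rfl⟩ := h.bijective_desc.surjective z
  induction p using SetPushout.ind with
  | hl x => exact Or.inl ⟨x, rfl⟩
  | hr x => exact Or.inr ⟨x, rfl⟩

theorem comp_surjective (h : IsSetPushout o i j j') {Y' : Type*} {e : Y' → Y}
    (he : Function.Surjective e) : IsSetPushout (o ∘ e) (i ∘ e) j j' :=
  of_retract (fun y => h.comm (e y)) h.jointly_surjective
    (fun z => SetPushout.desc (fun x => SetPushout.proj _ _ (Sum.inl x))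
      (fun x => SetPushout.proj _ _ (Sum.inr x)) (he.forall.2 SetPushout.glue) (h.equiv.symm z))
    (fun x => by rw [h.equiv_symm_left, SetPushout.desc_inl])
    (fun x => by rw [h.equiv_symm_right, SetPushout.desc_inr])

theorem sumElim (h : IsSetPushout o i j j') {K : Type*} {K' : Type u} (e : K ≃ K') (f : K → N') :
    IsSetPushout (Sum.map o e) (Sum.elim i f) (Sum.elim j (j' ∘ f ∘ e.symm)) j' := by
  let extend : SetPushout o i → SetPushout (Sum.map o e) (Sum.elim i f) :=
    SetPushout.desc (fun x => SetPushout.proj _ _ (Sum.inl (Sum.inl x)))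
      (fun x => SetPushout.proj _ _ (Sum.inr x)) (fun y => SetPushout.glue (Sum.inl y))
  refine of_retract ?_ (fun z => (h.jointly_surjective z).imp_left fun ⟨x, hx⟩ => ⟨Sum.inl x, hx⟩)
    (extend ∘ h.equiv.symm) ?_ (fun x => congrArg extend (h.equiv_symm_right x))
  · rintro (y | k)
    · exact h.comm y
    · exact congrArg (j' ∘ f) (e.symm_apply_apply k)
  · rintro (x | k)
    · exact congrArg extend (h.equiv_symm_left x)
    · obtain ⟨k, rfl⟩ := e.surjective k
      simp only [Sum.elim_inr, Function.comp_apply, e.symm_apply_apply, h.equiv_symm_right]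
      exact (SetPushout.glue (Sum.inr k)).symm

end IsSetPushout

theorem CospanClass.comp_mk_of_isSetPushout {l m n : ℕ} {N N' Z : Type u} [Finite N] [Finite N']
    [Finite Z] (i : Fin l → N) {o : Fin m → N} {i' : Fin m → N'} (o' : Fin n → N') {j : N → Z}
    {j' : N' → Z} (h : IsSetPushout o i' j j') :
    (mk ⟨N, i, o⟩).comp (mk ⟨N', i', o'⟩) = mk ⟨Z, j ∘ i, j' ∘ o'⟩ :=
  Quotient.sound ⟨⟨h.equiv, fun _ => rfl, fun _ => rfl⟩⟩

theorem CircuitClass.comp_mk_of_isSetPushout {L : Type u} {l m n : ℕ}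
    (c : Circuit L (Fin l) (Fin m)) (d : Circuit L (Fin m) (Fin n)) {Z : Type u} [Finite Z]
    {j : c.nodes → Z} {j' : d.nodes → Z} (h : IsSetPushout c.o d.i j j') :
    (mk c).comp (mk d) = mk
      { nodes := Z
        i := j ∘ c.i
        o := j' ∘ d.o
        edges := c.edges ⊕ d.edges
        s := Sum.elim (j ∘ c.s) (j' ∘ d.s)
        t := Sum.elim (j ∘ c.t) (j' ∘ d.t)
        label := Sum.elim c.label d.label } := by
  refine mk_eq ⟨⟨⟨h.equiv, fun _ => rfl, fun _ => rfl⟩, Equiv.refl _, ?_, ?_, fun _ => rfl⟩⟩ <;>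
    rintro (e | e) <;> rfl

theorem sumElim_comp_finSumFinEquiv_symm {α : Type*} {m n : ℕ} (f : Fin m → α) (g : Fin n → α) :
    Sum.elim f g ∘ finSumFinEquiv.symm = Fin.append f g := by
  ext x
  induction x using Fin.addCases <;> simp

theorem sumMap_comp_finSumFinEquiv_symm {α β : Type*} {m n : ℕ} (f : Fin m → α) (g : Fin n → β) :
    Sum.map f g ∘ finSumFinEquiv.symm = Fin.append (Sum.inl ∘ f) (Sum.inr ∘ g) :=
  sumElim_comp_finSumFinEquiv_symm _ _

theorem comp_append {α β : Type*} {m n : ℕ} (h : α → β) (f : Fin m → α) (g : Fin n → α) :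
    h ∘ Fin.append f g = Fin.append (h ∘ f) (h ∘ g) := by
  ext x
  induction x using Fin.addCases <;> simp

theorem FinCospan.map_mk_tensor_id {P : PropCat.{u + 1}} (G : PropCat.Hom FinCospan.{u} P)
    {N : Type u} [Finite N] {m n : ℕ} (i : Fin m → N) (o : Fin n → N) (p : ℕ) :
    P.tensor (G.map (CospanClass.mk ⟨N, i, o⟩)) (P.id p) =
      G.map (CospanClass.mk ⟨N ⊕ ULift.{u} (Fin p), Sum.map i ULift.up ∘ finSumFinEquiv.symm,
        Sum.map o ULift.up ∘ finSumFinEquiv.symm⟩) := by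
  rw [← G.map_id]
  exact (G.map_tensor _ _).symm

/-- A state `0 ⟶ arity` of a prop together with points of `N` to which its outputs are to be
attached. -/
structure AttachedState (P : PropCat.{v}) (N : Type u) where
  arity : ℕ
  state : P.hom 0 arity
  ends : Fin arity → N

namespace AttachedState

/-- Moving the attaching points along a function. -/
def map {P : PropCat.{v}} {N N' : Type*} (j : N → N') (e : AttachedState P N) :
    AttachedState P N' where
  arity := e.arity
  state := e.state
  ends := j ∘ e.ends

open PropCat

variable {P : PropCat.{u + 1}} (G : PropCat.Hom FinCospan.{u} P) {N N' Z : Type u} [Finite N]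
  [Finite N'] [Finite Z]

/-- The composite that creates the states in the list, and then connects their outputs and the
`m` inputs to the node set `N` of the cospan with legs `i` and `o`, read off through `G`. -/
def evalList {n : ℕ} (o : Fin n → N) :
    List (AttachedState P N) → ∀ {m : ℕ}, (Fin m → N) → P.hom m n
  | [], _, i => G.map (CospanClass.mk ⟨N, i, o⟩)
  | e :: es, m, i => P.comp (appendState m e.state) (evalList o es (Fin.append i e.ends))

theorem evalList_comp_cast {m m' n : ℕ} (h : m = m') (o : Fin n → N)
    (es : List (AttachedState P N)) (i : Fin m' → N) :
    evalList G o es (i ∘ Fin.cast h) = castHom h.symm rfl (evalList G o es i) := by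
  subst h; rfl

theorem map_comp_evalList {l n p : ℕ} (i : Fin l → N) {o : Fin n → N} {i' : Fin n → N'}
    (o' : Fin p → N') {j : N → Z} {j' : N' → Z} (h : IsSetPushout o i' j j')
    (es : List (AttachedState P N')) :
    P.comp (G.map (CospanClass.mk ⟨N, i, o⟩)) (evalList G o' es i') =
      evalList G (j' ∘ o') (es.map (map j')) (j ∘ i) := by
  induction es generalizing l n N with
  | nil =>
    exact (G.map_comp _ _).symm.trans
      (congrArg G.map (CospanClass.comp_mk_of_isSetPushout i o' h))
  | cons e es ih =>
    have enlarged : IsSetPushout (Sum.map o (ULift.up.{u} (α := Fin e.arity)) ∘ finSumFinEquiv.symm)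
        (Fin.append i' e.ends) (Sum.elim j (j' ∘ e.ends ∘ ULift.down)) j' := by
      rw [← sumElim_comp_finSumFinEquiv_symm]
      exact (h.sumElim Equiv.ulift.symm e.ends).comp_surjective finSumFinEquiv.symm.surjective
    have inputs_eq : Sum.elim j (j' ∘ e.ends ∘ ULift.down) ∘
        Sum.map i (ULift.up.{u} (α := Fin e.arity)) ∘ finSumFinEquiv.symm =
          Fin.append (j ∘ i) (j' ∘ e.ends) := by
      rw [← Function.comp_assoc, Sum.elim_comp_map, sumElim_comp_finSumFinEquiv_symm]
      rfl
    rw [evalList, ← P.assoc, comp_appendState, P.assoc, FinCospan.map_mk_tensor_id,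
      ih _ enlarged, inputs_eq]
    rfl

theorem map_comp_evalList_of_equiv {l n p : ℕ} (i : Fin l → N) (e : Fin n ≃ N) (i' : Fin n → N')
    (o' : Fin p → N') (es : List (AttachedState P N')) :
    P.comp (G.map (CospanClass.mk ⟨N, i, e⟩)) (evalList G o' es i') =
      evalList G o' es (i' ∘ e.symm ∘ i) := by
  have map_id : es.map (map id) = es := List.map_id es
  rw [map_comp_evalList G i o' (IsSetPushout.of_equiv e i'), map_id]
  rfl

theorem evalList_map_equiv {m n : ℕ} (f : N ≃ N') (o : Fin n → N)
    (es : List (AttachedState P N)) (i : Fin m → N) :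
    evalList G (f ∘ o) (es.map (map f)) (f ∘ i) = evalList G o es i := by
  induction es generalizing m with
  | nil =>
    exact congrArg G.map (Quotient.sound ⟨⟨f.symm, fun _ => f.symm_apply_apply _,
      fun _ => f.symm_apply_apply _⟩⟩)
  | cons e es ih =>
    simp only [List.map_cons, evalList, map, ← comp_append, ih]

theorem evalList_cons_cons {m n : ℕ} (o : Fin n → N) (e e' : AttachedState P N)
    (es : List (AttachedState P N)) (i : Fin m → N) :
    evalList G o (e :: e' :: es) i = P.comp (appendState m (P.tensor e.state e'.state))
      (evalList G o es (Fin.append i (Fin.append e.ends e'.ends))) := by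
  rw [evalList, evalList, Fin.append_assoc, evalList_comp_cast, appendState_tensor, ← P.assoc,
    P.comp_castHom_symm]

theorem whiskerLeft_braid_comp_evalList {m n p q : ℕ} (o : Fin n → N)
    (es : List (AttachedState P N)) (i : Fin m → N) (f : Fin p → N) (g : Fin q → N) :
    P.comp (P.tensor (P.id m) (P.braid p q))
      (evalList G o es (Fin.append i (Fin.append g f))) =
        evalList G o es (Fin.append i (Fin.append f g)) := by
  let e : Fin (m + (q + p)) ≃ ULift.{u} (Fin m) ⊕ ULift.{u} (Fin p ⊕ Fin q) :=
    finSumFinEquiv.symm.trans (Equiv.sumCongr Equiv.ulift.symm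
      ((finSumFinEquiv.symm.trans (Equiv.sumComm _ _)).trans Equiv.ulift.symm))
  have whisker_eq : P.tensor (P.id m) (P.braid p q) = G.map (CospanClass.mk
      ⟨ULift.{u} (Fin m) ⊕ ULift.{u} (Fin p ⊕ Fin q),
        Sum.map ULift.up (ULift.up ∘ finSumFinEquiv.symm) ∘ finSumFinEquiv.symm, e⟩) := by
    rw [← G.map_id, ← G.map_braid]
    exact (G.map_tensor _ _).symm
  rw [whisker_eq, map_comp_evalList_of_equiv]
  congr 1
  ext x
  induction x using Fin.addCases with
  | left x => simp [e]
  | right x => induction x using Fin.addCases <;> simp [e]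

theorem evalList_swap {m n : ℕ} (o : Fin n → N) (e e' : AttachedState P N)
    (es : List (AttachedState P N)) (i : Fin m → N) :
    evalList G o (e :: e' :: es) i = evalList G o (e' :: e :: es) i := by
  rw [evalList_cons_cons, evalList_cons_cons, ← tensor_comp_braid_of_states e.state e'.state,
    appendState_comp, P.assoc, whiskerLeft_braid_comp_evalList]

theorem evalList_perm {m n : ℕ} (o : Fin n → N) {es es' : List (AttachedState P N)}
    (h : es.Perm es') (i : Fin m → N) : evalList G o es i = evalList G o es' i := by
  induction h generalizing m with
  | nil => rfl
  | cons e _ ih => rw [evalList, evalList, ih]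
  | trans _ _ ih ih' => exact (ih i).trans (ih' i)
  | swap e e' es => exact evalList_swap G o e' e es i

theorem evalList_comp_evalList {l n p : ℕ} (i : Fin l → N) {o : Fin n → N} {i' : Fin n → N'}
    (o' : Fin p → N') {j : N → Z} {j' : N' → Z} (h : IsSetPushout o i' j j')
    (es : List (AttachedState P N)) (es' : List (AttachedState P N')) :
    P.comp (evalList G o es i) (evalList G o' es' i') =
      evalList G (j' ∘ o') (es.map (map j) ++ es'.map (map j')) (j ∘ i) := by
  induction es generalizing l with
  | nil => exact map_comp_evalList G i o' h es'
  | cons e es ih =>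
    rw [evalList, P.assoc, ih, comp_append]
    rfl

theorem whiskerLeft_evalList (r : ℕ) {m n : ℕ} (o : Fin n → N) (es : List (AttachedState P N))
    (i : Fin m → N) :
    P.tensor (P.id r) (evalList G o es i) =
      evalList G (Sum.map (ULift.up.{u} (α := Fin r)) o ∘ finSumFinEquiv.symm)
        (es.map (map Sum.inr)) (Sum.map ULift.up i ∘ finSumFinEquiv.symm) := by
  induction es generalizing m with
  | nil =>
    rw [← G.map_id]
    exact (G.map_tensor _ _).symm
  | cons e es ih =>
    have inputs_eq :
        Sum.map (ULift.up.{u} (α := Fin r)) (Fin.append i e.ends) ∘ finSumFinEquiv.symm =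
          Fin.append (Sum.map (ULift.up.{u} (α := Fin r)) i ∘ finSumFinEquiv.symm)
            (Sum.inr ∘ e.ends) ∘ Fin.cast (Nat.add_assoc r m e.arity).symm := by
      rw [sumMap_comp_finSumFinEquiv_symm, sumMap_comp_finSumFinEquiv_symm, comp_append,
        Fin.append_assoc]
      rfl
    rw [evalList, P.whiskerLeft_comp, ih, whiskerLeft_appendState, inputs_eq,
      evalList_comp_cast, ← P.castHom_comp]
    rfl

end AttachedState

namespace AttachedState

variable {P : PropCat.{u + 1}} (G : PropCat.Hom FinCospan.{u} P) {N N' Z : Type u} [Finite N]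
  [Finite N'] [Finite Z]

/-- `evalList` for unordered families of states. -/
def evalMultiset {m n : ℕ} (o : Fin n → N) (es : Multiset (AttachedState P N)) (i : Fin m → N) :
    P.hom m n :=
  Quot.liftOn es (fun l => evalList G o l i) fun _ _ h => evalList_perm G o h i

theorem evalMultiset_zero {m n : ℕ} (o : Fin n → N) (i : Fin m → N) :
    evalMultiset G o 0 i = G.map (CospanClass.mk ⟨N, i, o⟩) :=
  rfl

theorem evalMultiset_singleton {m n : ℕ} (o : Fin n → N) (e : AttachedState P N) (i : Fin m → N) :
    evalMultiset G o {e} i = P.comp (PropCat.appendState m e.state)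
      (G.map (CospanClass.mk ⟨N, Fin.append i e.ends, o⟩)) :=
  rfl

theorem evalMultiset_map_equiv {m n : ℕ} (f : N ≃ N') (o : Fin n → N)
    (es : Multiset (AttachedState P N)) (i : Fin m → N) :
    evalMultiset G (f ∘ o) (es.map (map f)) (f ∘ i) = evalMultiset G o es i :=
  Quotient.inductionOn es fun l => evalList_map_equiv G f o l i

theorem evalMultiset_comp_evalMultiset {l n p : ℕ} (i : Fin l → N) {o : Fin n → N}
    {i' : Fin n → N'} (o' : Fin p → N') {j : N → Z} {j' : N' → Z} (h : IsSetPushout o i' j j')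
    (es : Multiset (AttachedState P N)) (es' : Multiset (AttachedState P N')) :
    P.comp (evalMultiset G o es i) (evalMultiset G o' es' i') =
      evalMultiset G (j' ∘ o') (es.map (map j) + es'.map (map j')) (j ∘ i) :=
  Quotient.inductionOn₂ es es' fun l l' => evalList_comp_evalList G i o' h l l'

theorem whiskerLeft_evalMultiset (r : ℕ) {m n : ℕ} (o : Fin n → N)
    (es : Multiset (AttachedState P N)) (i : Fin m → N) :
    P.tensor (P.id r) (evalMultiset G o es i) =
      evalMultiset G (Sum.map (ULift.up.{u} (α := Fin r)) o ∘ finSumFinEquiv.symm)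
        (es.map (map Sum.inr)) (Sum.map ULift.up i ∘ finSumFinEquiv.symm) :=
  Quotient.inductionOn es fun l => whiskerLeft_evalList G r o l i

end AttachedState

namespace Circuit

variable {L : Type u} {P : PropCat.{u + 1}} (G : PropCat.Hom FinCospan.{u} P) (σ : L → P.hom 0 2)

/-- An edge of a circuit as a state attached at the source and the target, given for every label
the state of an edge with that label. -/
def attachedEdge {X Y : Type} (c : Circuit L X Y) (e : c.edges) : AttachedState P c.nodes where
  arity := 2
  state := σ (c.label e)
  ends := ![c.s e, c.t e]

/-- The family of all edges of a circuit as attached states. -/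
noncomputable def attachedEdges {X Y : Type} (c : Circuit L X Y) :
    Multiset (AttachedState P c.nodes) :=
  (Fintype.ofFinite c.edges).elems.val.map (c.attachedEdge σ)

theorem attachedEdges_eq {X Y : Type} (c : Circuit L X Y) (h : Fintype c.edges) :
    c.attachedEdges σ = (Finset.univ : Finset c.edges).val.map (c.attachedEdge σ) := by
  rw [attachedEdges, Subsingleton.elim (Fintype.ofFinite c.edges) h]
  rfl

theorem attachedEdges_toCircuit {X Y : Type} (c : Cospan.{u} X Y) :
    (c.toCircuit L).attachedEdges σ = 0 :=
  attachedEdges_eq σ (c.toCircuit L) (inferInstanceAs (Fintype PEmpty))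

theorem attachedEdges_edge (ℓ : L) : (edge ℓ).attachedEdges σ = {(edge ℓ).attachedEdge σ ⟨⟩} :=
  attachedEdges_eq σ (edge ℓ) (inferInstanceAs (Fintype PUnit))

theorem attachedEdge_map {X Y X' Y' : Type} {c : Circuit L X Y} {d : Circuit L X' Y'}
    {f : c.nodes → d.nodes} {e : c.edges} {e' : d.edges} (hs : f (c.s e) = d.s e')
    (ht : f (c.t e) = d.t e') (hl : d.label e' = c.label e) :
    (c.attachedEdge σ e).map f = d.attachedEdge σ e' := by
  simp only [attachedEdge, AttachedState.map, ← hs, ← ht, hl]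
  congr 1
  exact (FinVec.map_eq f _).symm

theorem attachedEdges_map {X Y X' Y' : Type} {c : Circuit L X Y} {d : Circuit L X' Y'}
    (f : c.nodes → d.nodes) (g : c.edges ≃ d.edges) (hs : ∀ e, f (c.s e) = d.s (g e))
    (ht : ∀ e, f (c.t e) = d.t (g e)) (hl : ∀ e, d.label (g e) = c.label e) :
    (c.attachedEdges σ).map (AttachedState.map f) = d.attachedEdges σ := by
  let := Fintype.ofFinite c.edges
  let := Fintype.ofFinite d.edges
  rw [attachedEdges_eq σ c ‹_›, attachedEdges_eq σ d ‹_›, ← Finset.map_univ_equiv g,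
    Finset.map_val, Multiset.map_map, Multiset.map_map]
  exact Multiset.map_congr rfl fun e _ => attachedEdge_map σ (hs e) (ht e) (hl e)

theorem attachedEdges_comp {X Y Z : Type} (c : Circuit L X Y) (d : Circuit L Y Z) :
    (c.comp d).attachedEdges σ =
      (c.attachedEdges σ).map (AttachedState.map fun x => SetPushout.proj c.o d.i (Sum.inl x)) +
      (d.attachedEdges σ).map (AttachedState.map fun x => SetPushout.proj c.o d.i (Sum.inr x)) := by
  let := Fintype.ofFinite c.edges
  let := Fintype.ofFinite d.edges
  have inl_eq (e : c.edges) :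
      ((c.attachedEdge σ e).map fun x => SetPushout.proj c.o d.i (Sum.inl x)) =
        (c.comp d).attachedEdge σ (Sum.inl e) :=
    attachedEdge_map σ (c := c) (d := c.comp d) (e' := Sum.inl e) rfl rfl rfl
  have inr_eq (e : d.edges) :
      ((d.attachedEdge σ e).map fun x => SetPushout.proj c.o d.i (Sum.inr x)) =
        (c.comp d).attachedEdge σ (Sum.inr e) :=
    attachedEdge_map σ (c := d) (d := c.comp d) (e' := Sum.inr e) rfl rfl rfl
  rw [attachedEdges_eq σ c ‹_›, attachedEdges_eq σ d ‹_›,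
    attachedEdges_eq σ (c.comp d) (inferInstanceAs (Fintype (c.edges ⊕ d.edges))),
    Multiset.map_map, Multiset.map_map]
  exact (Multiset.map_add _ _ _).trans (congrArg₂ (· + ·)
    ((Multiset.map_map _ _ _).trans (Multiset.map_congr rfl fun e _ => (inl_eq e).symm))
    ((Multiset.map_map _ _ _).trans (Multiset.map_congr rfl fun e _ => (inr_eq e).symm)))

/-- The morphism of `P` obtained from a circuit by reading its underlying cospan through `G` and an
edge labelled `ℓ` as the state `σ ℓ` attached at its two ends. -/
noncomputable def eval {m n : ℕ} (c : Circuit L (Fin m) (Fin n)) : P.hom m n :=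
  AttachedState.evalMultiset G c.o (c.attachedEdges σ) c.i

theorem eval_congr {m n : ℕ} {c d : Circuit L (Fin m) (Fin n)} (f : c.Iso d) :
    c.eval G σ = d.eval G σ := by
  rw [eval, ← AttachedState.evalMultiset_map_equiv G f.node,
    attachedEdges_map σ f.node f.edge f.s_eq f.t_eq f.label_eq, funext (f := f.node ∘ c.o) f.o_eq,
    funext (f := f.node ∘ c.i) f.i_eq, eval]

theorem eval_comp {l m n : ℕ} (c : Circuit L (Fin l) (Fin m)) (d : Circuit L (Fin m) (Fin n)) :
    (c.comp d).eval G σ = P.comp (c.eval G σ) (d.eval G σ) := by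
  rw [eval, eval, eval, attachedEdges_comp, AttachedState.evalMultiset_comp_evalMultiset G _ _
    (IsSetPushout.setPushout c.o d.i)]
  rfl

theorem eval_whiskerLeft (r : ℕ) {m n : ℕ} (c : Circuit L (Fin m) (Fin n)) :
    ((((Cospan.id (Fin r)).toCircuit L).tensor c).reindex finSumFinEquiv.symm
      finSumFinEquiv.symm).eval G σ = P.tensor (P.id r) (c.eval G σ) := by
  rw [eval, eval, AttachedState.whiskerLeft_evalMultiset]
  congr 1
  exact (attachedEdges_map σ Sum.inr (d := ((Cospan.id (Fin r)).toCircuit L).tensor c)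
    (Equiv.emptySum PEmpty c.edges).symm (fun _ => rfl) (fun _ => rfl) fun _ => rfl).symm

theorem eval_toCircuit {m n : ℕ} (c : Cospan.{u} (Fin m) (Fin n)) :
    (c.toCircuit L).eval G σ = G.map (CospanClass.mk c) := by
  rw [eval, attachedEdges_toCircuit]
  exact AttachedState.evalMultiset_zero G c.o c.i

end Circuit

namespace CircuitClass

variable {L : Type u} {P : PropCat.{u + 1}} (G : PropCat.Hom FinCospan.{u} P) (σ : L → P.hom 0 2)

/-- The value of `Circuit.eval` on an isomorphism class. -/
noncomputable def eval {m n : ℕ} (f : CircuitClass L m n) : P.hom m n :=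
  Quotient.lift (Circuit.eval G σ) (fun _ _ h => Nonempty.elim h (Circuit.eval_congr G σ)) f

theorem eval_comp {l m n : ℕ} (f : CircuitClass L l m) (g : CircuitClass L m n) :
    (f.comp g).eval G σ = P.comp (f.eval G σ) (g.eval G σ) :=
  Quotient.inductionOn₂ f g (Circuit.eval_comp G σ)

theorem eval_whiskerLeft (r : ℕ) {m n : ℕ} (f : CircuitClass L m n) :
    ((id L r).tensor f).eval G σ = P.tensor (P.id r) (f.eval G σ) :=
  Quotient.inductionOn f (Circuit.eval_whiskerLeft G σ r)

theorem eval_toCircuit {m n : ℕ} (f : CospanClass.{u} m n) :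
    (f.toCircuit L).eval G σ = G.map f :=
  Quotient.inductionOn f (Circuit.eval_toCircuit G σ)

theorem eval_braid (m n : ℕ) : (braid L m n).eval G σ = P.braid m n :=
  (eval_toCircuit G σ (CospanClass.braid m n)).trans (G.map_braid m n)

end CircuitClass

namespace Circ

variable {L : Type u} {P : PropCat.{u + 1}}

/-- `CircuitClass.eval` as a morphism of props. -/
noncomputable def evalHom (G : PropCat.Hom FinCospan.{u} P) (σ : L → P.hom 0 2) :
    PropCat.Hom (Circ L) P where
  map := CircuitClass.eval G σ
  map_id m := (CircuitClass.eval_toCircuit G σ (CospanClass.id m)).trans (G.map_id m)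
  map_comp := CircuitClass.eval_comp G σ
  map_tensor := PropCat.map_tensor_of_whiskerLeft (P := Circ L) (CircuitClass.eval G σ)
    (CircuitClass.eval_comp G σ) (CircuitClass.eval_braid G σ) (CircuitClass.eval_whiskerLeft G σ)
  map_braid := CircuitClass.eval_braid G σ

end Circ

namespace FinCospan

/-- The cospan `0 → 1 ← 2`, the unit of the self-duality of the object `1`. -/
def cup : CospanClass.{u} 0 2 := CospanClass.mk ⟨PUnit, Fin.elim0, fun _ => PUnit.unit⟩

/-- The cospan `2 → 1 ← 0`, the counit of the self-duality of the object `1`. -/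
def cap : CospanClass.{u} 2 0 := CospanClass.mk ⟨PUnit, fun _ => PUnit.unit, Fin.elim0⟩

theorem snake_cup_cap : PropCat.Snake (P := FinCospan.{u}) (p := 1) (q := 1) cup cap := by
  have isSetPushout : IsSetPushout (Y := Fin 3)
      (Sum.map (ULift.up.{u} (α := Fin 1)) (fun _ : Fin 2 => PUnit.unit.{u + 1}) ∘
        (finSumFinEquiv (m := 1) (n := 2)).symm)
      (Sum.map (fun _ : Fin 2 => PUnit.unit.{u + 1}) (ULift.up.{u} (α := Fin 1)) ∘
        (finSumFinEquiv (m := 2) (n := 1)).symm)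
      (fun _ => ULift.up.{u} (0 : Fin 1)) (fun _ => ULift.up.{u} (0 : Fin 1)) := by
    refine .of_retract (fun _ => rfl) (fun z => Or.inl ⟨Sum.inr PUnit.unit, Subsingleton.elim _ _⟩)
      (fun _ => SetPushout.proj _ _ (Sum.inr (Sum.inl PUnit.unit))) ?_ ?_
    · rintro (⟨x⟩ | _)
      · rw [Subsingleton.elim x 0]
        exact (SetPushout.glue (0 : Fin 3)).symm
      · exact (SetPushout.glue (1 : Fin 3)).symm
    · rintro (_ | ⟨x⟩)
      · rfl
      · rw [Subsingleton.elim x 0]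
        exact (SetPushout.glue (1 : Fin 3)).symm.trans (SetPushout.glue (2 : Fin 3))
  refine (CospanClass.comp_mk_of_isSetPushout _ _ isSetPushout).trans (Quotient.sound
    ⟨⟨Equiv.refl _, fun _ => ?_, fun _ => ?_⟩⟩) <;>
    exact Subsingleton.elim (α := ULift (Fin 1)) _ _

theorem cap_tensor_id : cap.{u}.tensor (CospanClass.id 1) =
    CospanClass.mk ⟨PUnit.{u + 1} ⊕ PUnit.{u + 1},
      Fin.append (fun _ : Fin 1 => Sum.inl PUnit.unit) ![Sum.inl PUnit.unit, Sum.inr PUnit.unit],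
      fun _ : Fin 1 => Sum.inr PUnit.unit⟩ := by
  refine Quotient.sound ⟨⟨Equiv.sumCongr (Equiv.refl _) (Equiv.equivPUnit (ULift (Fin 1))), ?_, ?_⟩⟩
  · intro x
    change Fin 3 at x
    fin_cases x <;> rfl
  · intro x
    change Fin 1 at x
    fin_cases x
    rfl

end FinCospan

namespace CircuitClass

variable {L : Type u} {P : PropCat.{u + 1}}

theorem eval_edge_of_bend (G : PropCat.Hom FinCospan.{u} P) (a : L → P.hom 1 1) (ℓ : L) :
    (mk (Circuit.edge ℓ)).eval G
      (fun ℓ => PropCat.bend (p := 1) (q := 1) (G.map FinCospan.cup) (a ℓ)) = a ℓ := by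
  have map_cap_tensor_id : G.map (FinCospan.cap.tensor (CospanClass.id 1)) =
      P.tensor (G.map FinCospan.cap) (P.id 1) := by
    rw [← G.map_id]
    exact G.map_tensor (m := 2) (n := 0) FinCospan.cap (CospanClass.id 1)
  refine Eq.trans ?_ ((FinCospan.snake_cup_cap.map G).unbend (a ℓ))
  rw [← map_cap_tensor_id, FinCospan.cap_tensor_id]
  exact (congrArg (AttachedState.evalMultiset G _ · _) (Circuit.attachedEdges_edge _ ℓ)).trans
    (AttachedState.evalMultiset_singleton G _ _ _)

end CircuitClass

namespace Circuit

variable {L : Type u}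

/-- A single edge with both ends as outputs: the circuit `Circuit.edge ℓ` with its input bent
around. -/
def edgeState (ℓ : L) : Circuit L (Fin 0) (Fin 2) where
  nodes := ULift (Fin 2)
  i := Fin.elim0
  o := ULift.up
  edges := PUnit
  s _ := ULift.up 0
  t _ := ULift.up 1
  label _ := ℓ

end Circuit

namespace CircuitClass

variable {L : Type u}

theorem bend_edge (ℓ : L) :
    PropCat.bend (P := Circ L) (p := 1) (q := 1) (FinCospan.cup.toCircuit L) (mk (Circuit.edge ℓ)) =
      mk (Circuit.edgeState ℓ) := by
  have isSetPushout : IsSetPushout (Y := Fin 2) (fun _ => PUnit.unit.{u + 1})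
      (Sum.map (ULift.up.{u} (α := Fin 1)) (Circuit.edge ℓ).i ∘
        (finSumFinEquiv (m := 1) (n := 1)).symm)
      (fun _ => ULift.up.{u} (0 : Fin 2))
      (Sum.elim (fun _ => ULift.up.{u} 0)
        (Sum.elim (fun _ => ULift.up 0) fun _ => ULift.up 1)) := by
    refine .of_retract ?_ ?_ (fun z => ![SetPushout.proj _ _ (Sum.inl PUnit.unit),
      SetPushout.proj _ _ (Sum.inr (Sum.inr (Sum.inr PUnit.unit)))] z.down) (fun _ => rfl) ?_
    · intro y
      fin_cases y <;> rfl
    · rintro ⟨z⟩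
      fin_cases z
      · exact Or.inl ⟨PUnit.unit, rfl⟩
      · exact Or.inr ⟨Sum.inr (Sum.inr PUnit.unit), rfl⟩
    · rintro (⟨x⟩ | _ | _)
      · rw [Subsingleton.elim x 0]
        exact SetPushout.glue (0 : Fin 2)
      · exact SetPushout.glue (1 : Fin 2)
      · rfl
  refine (comp_mk_of_isSetPushout (Cospan.toCircuit L ⟨PUnit, Fin.elim0, fun _ => PUnit.unit⟩)
    ((((Cospan.id (Fin 1)).toCircuit L).tensor (Circuit.edge ℓ)).reindex finSumFinEquiv.symm
      finSumFinEquiv.symm) isSetPushout).trans (mk_eq ⟨⟨⟨Equiv.refl _, fun x => x.elim0, ?_⟩,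
        (Equiv.emptySum PEmpty _).trans (Equiv.emptySum PEmpty PUnit), ?_, ?_, ?_⟩⟩)
  · intro x
    fin_cases x <;> rfl
  all_goals rintro (⟨⟨⟩⟩ | ⟨⟨⟩⟩ | _); rfl

theorem appendState_edgeState_comp {m n : ℕ} (c : Circuit L (Fin (m + 2)) (Fin n)) (ℓ : L) :
    (Circ L).comp (PropCat.appendState (P := Circ L) m (mk (Circuit.edgeState ℓ))) (mk c) =
      mk { nodes := c.nodes
           i := c.i ∘ Fin.castAdd 2
           o := c.o
           edges := Option c.edges
           s := fun e => e.elim (c.i (Fin.natAdd m 0)) c.s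
           t := fun e => e.elim (c.i (Fin.natAdd m 1)) c.t
           label := fun e => e.elim ℓ c.label } := by
  let e : Fin (m + 2) ≃ ULift.{u} (Fin m) ⊕ ULift.{u} (Fin 2) :=
    finSumFinEquiv.symm.trans (Equiv.sumCongr Equiv.ulift.symm Equiv.ulift.symm)
  refine (comp_mk_of_isSetPushout ((((Cospan.id.{u} (Fin m)).toCircuit L).tensor
    (Circuit.edgeState ℓ)).reindex finSumFinEquiv.symm finSumFinEquiv.symm) c
      (IsSetPushout.of_equiv e c.i)).trans ?_
  refine mk_eq ⟨⟨⟨Equiv.refl _, fun x => ?_, fun _ => rfl⟩,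
    ((Equiv.emptySum PEmpty PUnit).sumCongr (Equiv.refl _)).trans
      ((Equiv.sumComm _ _).trans (Equiv.optionEquivSumPUnit c.edges).symm), ?_, ?_, ?_⟩⟩
  · exact congrArg (fun z => c.i (e.symm (Sum.map ULift.up Fin.elim0 z)))
      (symm_cast_add_zero rfl x)
  all_goals rintro ((⟨⟨⟩⟩ | _) | _) <;> rfl

theorem mk_of_isEmpty_edges {m n : ℕ} (c : Circuit L (Fin m) (Fin n)) [IsEmpty c.edges] :
    mk c = (CospanClass.mk c.toCospan).toCircuit L :=
  mk_eq ⟨⟨⟨Equiv.refl _, fun _ => rfl, fun _ => rfl⟩, Equiv.equivPEmpty c.edges, isEmptyElim,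
    isEmptyElim, isEmptyElim⟩⟩

theorem mk_eq_appendState_edgeState_comp {m n : ℕ} (c : Circuit L (Fin m) (Fin n)) {E : Type u}
    [Finite E] (f : c.edges ≃ Option E) :
    mk c = (Circ L).comp
      (PropCat.appendState (P := Circ L) m (mk (Circuit.edgeState (c.label (f.symm none)))))
      (mk { nodes := c.nodes
            i := Fin.append c.i ![c.s (f.symm none), c.t (f.symm none)]
            o := c.o
            edges := E
            s := fun e => c.s (f.symm (some e))
            t := fun e => c.t (f.symm (some e))
            label := fun e => c.label (f.symm (some e)) }) := by
  rw [appendState_edgeState_comp]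
  refine mk_eq ⟨⟨⟨Equiv.refl _, fun x => ?_, fun _ => rfl⟩, f, ?_, ?_, ?_⟩⟩
  · exact (Fin.append_left _ _ x).symm
  all_goals
    refine f.symm.forall_congr_right.1 ?_
    rintro (_ | e) <;> simp

theorem induction_edges {motive : ∀ {m n : ℕ}, CircuitClass L m n → Prop}
    (toCircuit : ∀ {m n} (f : CospanClass.{u} m n), motive (f.toCircuit L))
    (comp : ∀ {m n} (ℓ : L) (f : CircuitClass L (m + 2) n), motive f → motive ((Circ L).comp
      (PropCat.appendState (P := Circ L) m (mk (Circuit.edgeState ℓ))) f))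
    {m n : ℕ} (f : CircuitClass L m n) : motive f := by
  have motive_mk (E : Type u) [Finite E] : ∀ {m n : ℕ} (c : Circuit L (Fin m) (Fin n)),
      (c.edges ≃ E) → motive (mk c) := by
    induction E using Finite.induction_empty_option with
    | of_equiv e ih => exact fun c f => ih c (f.trans e.symm)
    | h_empty =>
      intro m n c f
      have := f.isEmpty
      exact mk_of_isEmpty_edges c ▸ toCircuit _
    | h_option ih =>
      intro m n c f
      exact mk_eq_appendState_edgeState_comp c f ▸ comp _ _ (ih _ (Equiv.refl _))
  obtain ⟨c, rfl⟩ := mk_surj f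
  exact motive_mk c.edges c (Equiv.refl _)

end CircuitClass

namespace Circ

variable {L : Type u} {P : PropCat.{u + 1}}

theorem map_edgeState (F : PropCat.Hom (Circ L) P) (ℓ : L) :
    F.map (CircuitClass.mk (Circuit.edgeState ℓ)) = PropCat.bend (p := 1) (q := 1)
      (F.map (FinCospan.cup.toCircuit L)) (F.map (CircuitClass.mk (Circuit.edge ℓ))) := by
  rw [← CircuitClass.bend_edge]
  exact PropCat.map_bend F (p := 1) (q := 1) _ _

theorem map_appendState_edgeState_comp (F : PropCat.Hom (Circ L) P) {m n : ℕ} (ℓ : L)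
    (f : CircuitClass L (m + 2) n) :
    F.map ((Circ L).comp
      (PropCat.appendState (P := Circ L) m (CircuitClass.mk (Circuit.edgeState ℓ))) f) =
        P.comp (PropCat.appendState m (F.map (CircuitClass.mk (Circuit.edgeState ℓ)))) (F.map f) :=
  (F.map_comp _ _).trans (congrArg (P.comp · (F.map f)) (PropCat.map_appendState F m _))

theorem hom_ext {F F' : Circ L ⟶ P} (cospan : cospanToCirc L ≫ F = cospanToCirc L ≫ F')
    (action : actionToCirc L ≫ F = actionToCirc L ≫ F') : F = F' := by
  have map_toCircuit {m n : ℕ} (f : CospanClass.{u} m n) :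
      F.map (f.toCircuit L) = F'.map (f.toCircuit L) :=
    congrArg (fun H : PropCat.Hom FinCospan.{u} P => H.map f) cospan
  have map_edge (ℓ : L) : F.map (CircuitClass.mk (Circuit.edge ℓ)) =
      F'.map (CircuitClass.mk (Circuit.edge ℓ)) :=
    congrArg (fun H : PropCat.Hom (ActionProp L) P => H.map (FreeProp.mk (.gen (.op ℓ)))) action
  refine PropCat.Hom.ext ?_
  funext m n f
  induction f using CircuitClass.induction_edges with
  | toCircuit f => exact map_toCircuit f
  | comp ℓ f ih =>
    rw [map_appendState_edgeState_comp, map_appendState_edgeState_comp, map_edgeState,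
      map_edgeState, map_toCircuit, map_edge, ih]

/-- The morphism out of `Circ L` induced by morphisms out of `FinCospan` and `ActionProp L`. -/
noncomputable def desc (G : FinCospan.{u} ⟶ P) (A : ActionProp L ⟶ P) : Circ L ⟶ P :=
  evalHom G fun ℓ => PropCat.bend (p := 1) (q := 1) (PropCat.Hom.map G FinCospan.cup)
    (PropCat.Hom.map A (FreeProp.mk (.gen (.op ℓ))))

theorem cospanToCirc_comp_desc (G : FinCospan.{u} ⟶ P) (A : ActionProp L ⟶ P) :
    cospanToCirc L ≫ desc G A = G := by
  refine PropCat.Hom.ext ?_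
  funext m n f
  exact CircuitClass.eval_toCircuit G _ f

theorem actionToCirc_comp_desc (G : FinCospan.{u} ⟶ P) (A : ActionProp L ⟶ P) :
    actionToCirc L ≫ desc G A = A := by
  refine FreeProp.hom_ext ?_
  rintro _ _ ⟨ℓ⟩
  exact CircuitClass.eval_edge_of_bend G _ ℓ

end Circ

theorem mainTheorem2 (L : Type u) :
    Nonempty (Limits.IsColimit (Limits.BinaryCofan.mk (cospanToCirc L) (actionToCirc L))) := by
  exact ⟨Limits.BinaryCofan.isColimitMk (fun s => Circ.desc s.inl s.inr)
    (fun s => Circ.cospanToCirc_comp_desc s.inl s.inr)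
    (fun s => Circ.actionToCirc_comp_desc s.inl s.inr)
    fun s _ inl_fac inr_fac => Circ.hom_ext
      (inl_fac.trans (Circ.cospanToCirc_comp_desc s.inl s.inr).symm)
      (inr_fac.trans (Circ.actionToCirc_comp_desc s.inl s.inr).symm)⟩
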